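/- All systems are finite-dimensional, all alphabets are finite, and $\log=\log_2$. For a normalised state $\alpha$ and a state $\beta$ on the same space and $0<\epsilon<1$ let $$D_H^\epsilon(\alpha\|\beta):=\max\{-\log\operatorname{Tr}[\Pi\beta]\;:\;0\le\Pi\le 1,\ \operatorname{Tr}[\Pi\alpha]\ge 1-\epsilon\},$$ $$D_\infty(\alpha\|\beta):=\log\|\beta^{-1/2}\alpha\beta^{-1/2}\|_\infty \text{ if } \operatorname{supp}\alpha\subseteq\operatorname{supp}\beta,\quad +\infty\text{ otherwise}$$ (with $\|\cdot\|_\infty$ the operator norm and $\beta^{-1/2}$ taken on the support of $\beta$ and zero elsewhere), and $$D_\infty^\epsilon(\alpha\|\beta):=\min\{D_\infty(\alpha'\|\beta)\;:\;\alpha'\ge 0,\ \operatorname{Tr}\alpha'\le 1,\ \|\alpha'-\alpha\|_1\le\epsilon\operatorname{Tr}\alpha\}.$$ For a bipartite state put $I_H^\epsilon(X:B)_\rho:=D_H^\epsilon(\rho^{XB}\|\rho^X\otimes\rho^B)$ and $I_\infty^\epsilon(X:E)_\rho:=D_\infty^\epsilon(\rho^{XE}\|\rho^X\otimes\rho^E)$.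 **Theorem.** Let $t\ge 2$ and let $\mathcal T^{A\to BE_1\cdots E_t}$ be a completely positive trace preserving map (a quantum wiretap channel from the sender $A$ to the legitimate receiver $B$ with non-interacting eavesdroppers $E_1,\dots,E_t$). Let $p$ be a probability distribution on an alphabet $X$, let $\rho_x^A$ be a normalised state on $A$ for each $x\in X$, and let $$\rho^{XBE_1\cdots E_t}:=\sum_{x\in X}p(x)\,|x\rangle\langle x|^X\otimes\mathcal T(\rho^A_x).$$ Let $0<\epsilon<1$ and let $R$ be a real number with $$R<I_H^\epsilon(X:B)_\rho-\max_{1\le i\le t}I_\infty^\epsilon(X:E_i)_\rho-\frac{4\log t}{\epsilon^2}.$$ Then there is a private classical code with $M=\lceil 2^R\rceil$ messages, i.e. normalised states $\omega(1),\dots,\omega(M)$ on $A$ and a POVM $\Lambda_1,\dots,\Lambda_M$ on $B$, such that, with $\sigma(m):=\mathcal T(\omega(m))$, for every message $m$: * (correctness) the error probability $1-\operatorname{Tr}[\Lambda_m\sigma^B(m)]$ is at most $2\epsilon$; * (privacy) $\|\sigma^{E_i}(m)-\rho^{E_i}\|_1<4\epsilon$ for all $i=1,\dots,t$. In particular the bound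 does not depend on the dimensions of the eavesdroppers' systems. -/

import Mathlib

open scoped Matrix Kronecker ComplexOrder

namespace QInfo

noncomputable section

/-! ### States, tests and channels on finite-dimensional systems

A quantum system is given by a finite type of basis labels; operators on it are complex matrices. -/

/-- Normalised density matrices. -/
def IsState {S : Type*} [Fintype S] (ρ : Matrix S S ℂ) : Prop :=
  ρ.PosSemidef ∧ ρ.trace = 1

/-- Subnormalised density matrices. -/
def IsSubState {S : Type*} [Fintype S] (ρ : Matrix S S ℂ) : Prop :=
  ρ.PosSemidef ∧ ρ.trace.re ≤ 1

/-- POVM elements, i.e. matrices `P` with `0 ≤ P ≤ 1`. -/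
def IsEffect {S : Type*} [DecidableEq S] (P : Matrix S S ℂ) : Prop :=
  P.PosSemidef ∧ (1 - P).PosSemidef

/-- Probability distributions on a finite alphabet. -/
def IsProb {X : Type*} [Fintype X] (p : X → ℝ) : Prop :=
  (∀ x, 0 ≤ p x) ∧ ∑ x, p x = 1

/-- The map `T ⊗ id_k` applied to a matrix on the tensor product with a `k`-dimensional system. -/
def ampliation {A S : Type*} (T : Matrix A A ℂ →ₗ[ℂ] Matrix S S ℂ) (k : ℕ)
    (M : Matrix (A × Fin k) (A × Fin k) ℂ) : Matrix (S × Fin k) (S × Fin k) ℂ :=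
  Matrix.of fun u v => T (Matrix.of fun a a' => M (a, u.2) (a', v.2)) u.1 v.1

/-- Completely positive trace preserving superoperators. -/
def IsCPTP {A S : Type*} [Fintype A] [Fintype S]
    (T : Matrix A A ℂ →ₗ[ℂ] Matrix S S ℂ) : Prop :=
  (∀ (k : ℕ) (M : Matrix (A × Fin k) (A × Fin k) ℂ),
      M.PosSemidef → (ampliation T k M).PosSemidef) ∧
    ∀ M : Matrix A A ℂ, (T M).trace = M.trace

/-- Partial trace: the system `S` is split as `K ⊗ D`, the part `K` is kept and `D` is traced
out. -/
def reduce {S K D : Type*} [Fintype D] (e : S ≃ K × D) (σ : Matrix S S ℂ) : Matrix K K ℂ :=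
  Matrix.of fun k k' => ∑ d, σ (e.symm (k, d)) (e.symm (k', d))

/-- The marginal on the first factor. -/
def margFst {S S' : Type*} [Fintype S'] (σ : Matrix (S × S') (S × S') ℂ) : Matrix S S ℂ :=
  reduce (Equiv.refl (S × S')) σ

/-- The marginal on the second factor. -/
def margSnd {S S' : Type*} [Fintype S] (σ : Matrix (S × S') (S × S') ℂ) : Matrix S' S' ℂ :=
  reduce (Equiv.prodComm S S') σ

/-! ### Norms, powers, supports, logarithms -/

/-- The Schatten `1`-norm `Tr √(M† M)`. -/
def traceNorm {S : Type*} [Fintype S] [DecidableEq S] (M : Matrix S S ℂ) : ℝ :=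
  (cfc Real.sqrt (Mᴴ * M)).trace.re

/-- The Schatten `∞`-norm, i.e. the operator norm with respect to the Euclidean norm. -/
def opNorm {S : Type*} [Fintype S] [DecidableEq S] (M : Matrix S S ℂ) : ℝ :=
  ‖Matrix.toEuclideanCLM (𝕜 := ℂ) M‖

/-- The support of a Hermitian matrix (the span of its non-zero eigenspaces, which is its
range). -/
def supp {S : Type*} [Fintype S] (M : Matrix S S ℂ) : Submodule ℂ (S → ℂ) :=
  LinearMap.range M.mulVecLin

/-- The power `β ^ (-1/2)` on the support of `β`, and zero on the kernel of `β`
(note that `(0 : ℝ) ^ (-1/2 : ℝ) = 0`). -/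
def invSqrt {S : Type*} [Fintype S] [DecidableEq S] (β : Matrix S S ℂ) : Matrix S S ℂ :=
  cfc (fun x : ℝ => x ^ (-1 / 2 : ℝ)) β

/-- Binary logarithm of a nonnegative real, with `log 0 = -∞`. -/
def elog (x : ℝ) : EReal := if x ≤ 0 then ⊥ else (Real.logb 2 x : EReal)

/-! ### Divergences and mutual informations -/

/-- The smooth hypothesis testing divergence
`max {-log Tr[P β] : 0 ≤ P ≤ 1, Tr[P α] ≥ 1 - ε}`. -/
def DH {S : Type*} [Fintype S] [DecidableEq S] (ε : ℝ) (α β : Matrix S S ℂ) : EReal :=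
  ⨆ P ∈ {P : Matrix S S ℂ | IsEffect P ∧ 1 - ε ≤ (P * α).trace.re}, -elog (P * β).trace.re

open Classical in
/-- The Rényi max divergence. -/
def Dinf {S : Type*} [Fintype S] [DecidableEq S] (α β : Matrix S S ℂ) : EReal :=
  if supp α ≤ supp β then elog (opNorm (invSqrt β * α * invSqrt β)) else ⊤

/-- The `ε`-smooth Rényi max divergence. -/
def DinfSmooth {S : Type*} [Fintype S] [DecidableEq S] (ε : ℝ) (α β : Matrix S S ℂ) : EReal :=
  ⨅ α' ∈ {α' : Matrix S S ℂ | IsSubState α' ∧ traceNorm (α' - α) ≤ ε * α.trace.re}, Dinf α' β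

/-- The smooth hypothesis testing mutual information of a bipartite state. -/
def IH {S S' : Type*} [Fintype S] [DecidableEq S] [Fintype S'] [DecidableEq S'] (ε : ℝ)
    (σ : Matrix (S × S') (S × S') ℂ) : EReal :=
  DH ε σ (margFst σ ⊗ₖ margSnd σ)

/-- The smooth Rényi max mutual information of a bipartite state. -/
def IinfSmooth {S S' : Type*} [Fintype S] [DecidableEq S] [Fintype S'] [DecidableEq S'] (ε : ℝ)
    (σ : Matrix (S × S') (S × S') ℂ) : EReal :=
  DinfSmooth ε σ (margFst σ ⊗ₖ margSnd σ)

/-! ### The wiretap channel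

The output system is `B ⊗ E₁ ⊗ ⋯ ⊗ E_t`, with basis labels `B × ∀ i, E i`. -/

/-- Splits `B E₁ ⋯ E_t` into `E_i` and the rest. -/
def splitEve {t : ℕ} (B : Type*) (E : Fin t → Type*) (i : Fin t) :
    B × (∀ j, E j) ≃ E i × (B × ∀ j : {j : Fin t // j ≠ i}, E j) where
  toFun u := (u.2 i, (u.1, fun j => u.2 j))
  invFun v := (v.2.1, (Equiv.piSplitAt i E).symm (v.1, v.2.2))
  left_inv u := Prod.ext rfl ((Equiv.piSplitAt i E).symm_apply_apply u.2)
  right_inv v := by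
    have h := (Equiv.piSplitAt i E).apply_symm_apply (v.1, v.2.2)
    have h1 : (Equiv.piSplitAt i E).symm (v.1, v.2.2) i = v.1 := congrArg Prod.fst h
    have h2 : (fun j : {j : Fin t // j ≠ i} => (Equiv.piSplitAt i E).symm (v.1, v.2.2) j) = v.2.2 :=
      congrArg Prod.snd h
    exact Prod.ext h1 (Prod.ext rfl h2)

/-- The control state `∑ x, p x |x⟩⟨x| ⊗ T (ρ x)`. -/
def controlState {X A S : Type*} [Fintype X] [DecidableEq X]
    (T : Matrix A A ℂ →ₗ[ℂ] Matrix S S ℂ) (p : X → ℝ) (ρ : X → Matrix A A ℂ) :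
    Matrix (X × S) (X × S) ℂ :=
  ∑ x, (p x : ℂ) • (Matrix.single x x (1 : ℂ) ⊗ₖ T (ρ x))

/-- The marginal on `X B` of a state on `X B E₁ ⋯ E_t`. -/
def margXB {t : ℕ} {X B : Type*} {E : Fin t → Type*} [∀ i, Fintype (E i)]
    (σ : Matrix (X × B × ∀ i, E i) (X × B × ∀ i, E i) ℂ) : Matrix (X × B) (X × B) ℂ :=
  reduce (Equiv.prodAssoc X B (∀ i, E i)).symm σ

/-- The marginal on `X E_i` of a state on `X B E₁ ⋯ E_t`. -/
def margXE {t : ℕ} {X B : Type*} {E : Fin t → Type*} [Fintype B] [∀ i, Fintype (E i)]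
    (i : Fin t) (σ : Matrix (X × B × ∀ i, E i) (X × B × ∀ i, E i) ℂ) :
    Matrix (X × E i) (X × E i) ℂ :=
  reduce (((Equiv.refl X).prodCongr (splitEve B E i)).trans (Equiv.prodAssoc X (E i) _).symm) σ

/-- The marginal on `E_i` of a state on `B E₁ ⋯ E_t`. -/
def margE {t : ℕ} {B : Type*} {E : Fin t → Type*} [Fintype B] [∀ i, Fintype (E i)]
    (i : Fin t) (σ : Matrix (B × ∀ i, E i) (B × ∀ i, E i) ℂ) : Matrix (E i) (E i) ℂ :=
  reduce (splitEve B E i) σ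

/-- A private classical code with `M` messages, from a sender `A` to a receiver `B`: to send `m`
the sender inputs the (in general mixed) state `enc m`; the receiver decodes with the POVM
`dec`. -/
structure PrivateCode (A B : Type*) [Fintype A] [Fintype B] [DecidableEq B] (M : ℕ) where
  enc : Fin M → Matrix A A ℂ
  enc_state : ∀ m, IsState (enc m)
  dec : Fin M → Matrix B B ℂ
  dec_pos : ∀ m, (dec m).PosSemidef
  dec_sum : ∑ m, dec m = 1

/-- The probability that message `m`, sent over `T`, is decoded incorrectly by `B`. -/
def PrivateCode.errorProb {t : ℕ} {A B : Type*} {E : Fin t → Type*} [Fintype A] [Fintype B]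
    [DecidableEq B] [∀ i, Fintype (E i)] {M : ℕ} (C : PrivateCode A B M)
    (T : Matrix A A ℂ →ₗ[ℂ] Matrix (B × ∀ i, E i) (B × ∀ i, E i) ℂ) (m : Fin M) : ℝ :=
  1 - (C.dec m * margFst (T (C.enc m))).trace.re

/-- The state of eavesdropper `E_i` when message `m` is sent over `T`. -/
def PrivateCode.eveState {t : ℕ} {A B : Type*} {E : Fin t → Type*} [Fintype A] [Fintype B]
    [DecidableEq B] [∀ i, Fintype (E i)] {M : ℕ} (C : PrivateCode A B M)
    (T : Matrix A A ℂ →ₗ[ℂ] Matrix (B × ∀ i, E i) (B × ∀ i, E i) ℂ) (i : Fin t) (m : Fin M) :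
    Matrix (E i) (E i) ℂ :=
  margE i (T (C.enc m))

end

end QInfo

open QInfo

/-! Random coding with expurgation. Every message receives `K` letters drawn independently from `p`,
and the sender transmits the uniform mixture of their states. Fix reals `a` below the receiver's
information and `b` above the information of every eavesdropper.

Receiver: the optimal test for `IH` splits into one effect per letter, and a pretty good measurement
built from these effects identifies the transmitted letter itself. The Hayashi–Nagaoka inequality
(`hayashi_nagaoka`, `exists_decoder`) bounds the error by a multiple of `ε` plus a collision term,
the number of codewords times `2 ^ (-a)`.

Eavesdroppers: smoothing replaces the states by operators dominated by `2 ^ b` times the average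
state `τ`. Cauchy–Schwarz turns the trace norm into the Hilbert–Schmidt form weighted by the inverse
of `τ`, for which the variance of an empirical mean is at most of order `2 ^ b / K`
(`expect_traceNorm_sq_le`). No matrix concentration bound enters, so no dimension appears.

Error and leakage are added into a single nonnegative potential whose mean is at most `1 - 1 / N`
for each of `N * M` candidate messages; hence some draw leaves `M` candidates with potential below
`1`, and these meet all requirements at once (`exists_code`). The union over eavesdroppers puts a
factor `t` into `K`, paid for by `t ^ (-4 / ε ^ 2)`. This covers `ε < 2 / 5`. For `2 / 5 ≤ ε < 1 /
2` mixing each codeword with the average input gives privacy, and for `ε ≥ 1 / 2` or a single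
message a constant encoding suffices. -/

namespace QInfo

/-! ### Traces of products of positive matrices -/

section Trace
open scoped MatrixOrder

variable {S : Type*} [Fintype S]

theorem trace_mul_re_nonneg {A B : Matrix S S ℂ} (hA : A.PosSemidef) (hB : B.PosSemidef) :
    0 ≤ (A * B).trace.re := by
  classical
  obtain ⟨C, rfl⟩ := (CStarAlgebra.nonneg_iff_eq_star_mul_self (a := B)).1 hB.nonneg
  rw [Matrix.star_eq_conjTranspose, ← mul_assoc, Matrix.trace_mul_comm, ← mul_assoc]
  exact (Complex.nonneg_iff.1 (hA.mul_mul_conjTranspose_same C).trace_nonneg).1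

theorem trace_mul_re_mono {P A B : Matrix S S ℂ} (hP : P.PosSemidef) (h : A ≤ B) :
    (P * A).trace.re ≤ (P * B).trace.re := by
  have := trace_mul_re_nonneg hP (Matrix.le_iff.1 h)
  rw [mul_sub, Matrix.trace_sub, Complex.sub_re] at this
  linarith

theorem trace_re_nonneg {A : Matrix S S ℂ} (hA : A.PosSemidef) : 0 ≤ A.trace.re :=
  (Complex.nonneg_iff.1 hA.trace_nonneg).1

theorem trace_re_mono {A B : Matrix S S ℂ} (h : A ≤ B) : A.trace.re ≤ B.trace.re := by
  have := trace_re_nonneg (Matrix.le_iff.1 h)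
  rw [Matrix.trace_sub, Complex.sub_re] at this
  linarith

end Trace

/-! ### The trace norm and its dual description -/

section TraceNorm
open scoped MatrixOrder

variable {S : Type*} [Fintype S] [DecidableEq S]

theorem continuousOn_spectrum (f : ℝ → ℝ) (M : Matrix S S ℂ) :
    ContinuousOn f (spectrum ℝ M) := (Matrix.finite_real_spectrum).continuousOn f

theorem traceNorm_eq_of_hermitian {M : Matrix S S ℂ} (hM : M.IsHermitian) :
    traceNorm M = (cfc (fun x : ℝ => |x|) M).trace.re := by
  unfold traceNorm
  have hM' : IsSelfAdjoint M := hM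
  congr 2
  have : Mᴴ * M = cfc (fun x : ℝ => x * x) M := by
    rw [cfc_mul (fun x : ℝ => x) (fun x : ℝ => x) M, cfc_id' ℝ M, hM.eq]
  rw [this, ← cfc_comp Real.sqrt (fun x : ℝ => x * x) M hM'
    ((Matrix.finite_real_spectrum.image _).continuousOn _) (continuousOn_spectrum _ _)]
  congr 1
  funext x
  exact Real.sqrt_mul_self_eq_abs x

/-- Dual lower bound for the trace norm of a Hermitian matrix. -/
theorem trace_mul_le_traceNorm {M : Matrix S S ℂ} (hM : M.IsHermitian) {P : Matrix S S ℂ}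
    (h1 : (1 - P).PosSemidef) (h2 : (1 + P).PosSemidef) : (P * M).trace.re ≤ traceNorm M := by
  have hM' : IsSelfAdjoint M := hM
  rw [traceNorm_eq_of_hermitian hM]
  set N := cfc (fun x : ℝ => |x|) M with hN
  have e1 : (N + M).PosSemidef := by
    have : N + M = cfc (fun x : ℝ => |x| + x) M := by
      rw [cfc_add M (fun x : ℝ => |x|) (fun x : ℝ => x) (continuousOn_spectrum _ _)
        (continuousOn_spectrum _ _), cfc_id' ℝ M]
    rw [this, ← Matrix.nonneg_iff_posSemidef]
    exact cfc_nonneg fun x _ => by linarith [neg_abs_le x]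
  have e2 : (N - M).PosSemidef := by
    have : N - M = cfc (fun x : ℝ => |x| - x) M := by
      rw [cfc_sub (fun x : ℝ => |x|) (fun x : ℝ => x) M (continuousOn_spectrum _ _)
        (continuousOn_spectrum _ _), cfc_id' ℝ M]
    rw [this, ← Matrix.nonneg_iff_posSemidef]
    exact cfc_nonneg fun x _ => by linarith [le_abs_self x]
  have f1 := trace_mul_re_nonneg h1 e1
  have f2 := trace_mul_re_nonneg h2 e2
  -- `N ± M` are twice the positive and negative parts of `M`, so both products have nonnegative
  -- trace; their sum compares `N` with `P * M`.
  have : (1 - P) * (N + M) + (1 + P) * (N - M) = N + N - (P * M + P * M) := by noncomm_ring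
  have h := congrArg (fun A => A.trace.re) this
  simp only [Matrix.trace_add, Matrix.trace_sub, Complex.add_re, Complex.sub_re] at h
  linarith

/-- The dual lower bound is attained. -/
theorem exists_trace_mul_eq_traceNorm {M : Matrix S S ℂ} (hM : M.IsHermitian) :
    ∃ P : Matrix S S ℂ, P.IsHermitian ∧ (1 - P).PosSemidef ∧ (1 + P).PosSemidef ∧
      (P * M).trace.re = traceNorm M := by
  have hM' : IsSelfAdjoint M := hM
  refine ⟨cfc (fun x : ℝ => (SignType.sign x : ℝ)) M, cfc_predicate _ _, ?_, ?_, ?_⟩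
  · rw [← cfc_const_one ℝ M, ← cfc_sub _ _ M (continuousOn_spectrum _ _)
      (continuousOn_spectrum _ _), ← Matrix.nonneg_iff_posSemidef]
    refine cfc_nonneg fun x _ => ?_
    rcases lt_trichotomy x 0 with h | h | h <;> simp [h]
  · rw [← cfc_const_one ℝ M, ← cfc_add M _ _ (continuousOn_spectrum _ _)
      (continuousOn_spectrum _ _), ← Matrix.nonneg_iff_posSemidef]
    refine cfc_nonneg fun x _ => ?_
    rcases lt_trichotomy x 0 with h | h | h <;> simp [h]
  · rw [traceNorm_eq_of_hermitian hM]
    conv_lhs => rw [← cfc_id' ℝ M]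
    rw [cfc_id' ℝ M]
    nth_rewrite 2 [← cfc_id' ℝ M]
    rw [← cfc_mul _ _ M (continuousOn_spectrum _ _) (continuousOn_spectrum _ _)]
    congr 3
    funext x
    exact sign_mul_self x

theorem traceNorm_nonneg {M : Matrix S S ℂ} (hM : M.IsHermitian) : 0 ≤ traceNorm M := by
  have := trace_mul_le_traceNorm hM (P := 0) (by simpa using Matrix.PosSemidef.one)
    (by simpa using Matrix.PosSemidef.one)
  simpa using this

theorem traceNorm_zero : traceNorm (0 : Matrix S S ℂ) = 0 := by
  obtain ⟨P, -, -, -, h⟩ := exists_trace_mul_eq_traceNorm (Matrix.isHermitian_zero (n := S) (α := ℂ))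
  simpa using h.symm

theorem traceNorm_add_le {M N : Matrix S S ℂ} (hM : M.IsHermitian) (hN : N.IsHermitian) :
    traceNorm (M + N) ≤ traceNorm M + traceNorm N := by
  obtain ⟨P, -, h1, h2, h⟩ := exists_trace_mul_eq_traceNorm (hM.add hN)
  rw [← h, mul_add, Matrix.trace_add, Complex.add_re]
  exact add_le_add (trace_mul_le_traceNorm hM h1 h2) (trace_mul_le_traceNorm hN h1 h2)

theorem traceNorm_smul_le {M : Matrix S S ℂ} (hM : M.IsHermitian) {r : ℝ} (hr : 0 ≤ r) :
    traceNorm (r • M) ≤ r * traceNorm M := by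
  obtain ⟨P, -, h1, h2, h⟩ := exists_trace_mul_eq_traceNorm (M := r • M)
    (hM.smul (IsSelfAdjoint.all r))
  rw [← h, mul_smul_comm, Matrix.trace_smul, Complex.smul_re, smul_eq_mul]
  exact mul_le_mul_of_nonneg_left (trace_mul_le_traceNorm hM h1 h2) hr

theorem traceNorm_sum_le {ι : Type*} (s : Finset ι) {M : ι → Matrix S S ℂ}
    (hM : ∀ i, (M i).IsHermitian) : traceNorm (∑ i ∈ s, M i) ≤ ∑ i ∈ s, traceNorm (M i) := by
  classical
  have hs : ∀ s : Finset ι, (∑ i ∈ s, M i).IsHermitian := fun s =>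
    isSelfAdjoint_sum s (fun i _ => hM i)
  induction s using Finset.induction_on with
  | empty => simp [traceNorm_zero]
  | insert a s ha ih =>
    rw [Finset.sum_insert ha, Finset.sum_insert ha]
    exact (traceNorm_add_le (hM a) (hs s)).trans (by linarith)

theorem traceNorm_sub_le_trace_add {A B : Matrix S S ℂ} (hA : A.PosSemidef) (hB : B.PosSemidef) :
    traceNorm (A - B) ≤ A.trace.re + B.trace.re := by
  obtain ⟨P, -, h1, h2, h⟩ := exists_trace_mul_eq_traceNorm (hA.1.sub hB.1)
  have f1 := trace_mul_re_nonneg h1 hA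
  have f2 := trace_mul_re_nonneg h2 hB
  rw [← h]
  simp only [sub_mul, add_mul, mul_sub, one_mul, Matrix.trace_add, Matrix.trace_sub,
    Complex.add_re, Complex.sub_re] at f1 f2 ⊢
  linarith

theorem trace_sub_le_traceNorm {A B : Matrix S S ℂ} (hA : A.IsHermitian) (hB : B.IsHermitian) :
    B.trace.re - A.trace.re ≤ traceNorm (A - B) := by
  have h2 : (1 + 1 : Matrix S S ℂ).PosSemidef := Matrix.PosSemidef.one.add Matrix.PosSemidef.one
  have := trace_mul_le_traceNorm (hA.sub hB) (P := -1) (by simpa using h2)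
    (by simpa using Matrix.PosSemidef.zero)
  simpa using this

end TraceNorm

/-! ### The Hayashi–Nagaoka inequality and the decoder -/

section HayashiNagaoka
open scoped MatrixOrder

variable {S : Type*} [Fintype S] [DecidableEq S]

theorem IsEffect.mul_self_le {P : Matrix S S ℂ} (hP : IsEffect P) : P * P ≤ P := by
  have h1 := hP.2.conjTranspose_mul_mul_same P
  have h2 := hP.1.conjTranspose_mul_mul_same (1 - P)
  rw [hP.1.1.eq] at h1
  rw [hP.2.1.eq] at h2
  have : P - P * P = P * (1 - P) * P + (1 - P) * P * (1 - P) := by noncomm_ring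
  rw [Matrix.le_iff, this]
  exact h1.add h2

open scoped Matrix.Norms.L2Operator in
-- Operator monotonicity of the square root, applied to `P * P ≤ P ≤ A`.
theorem IsEffect.le_sqrt {P A : Matrix S S ℂ} (hP : IsEffect P) (hA : P ≤ A) :
    P ≤ CFC.sqrt A := by
  have h := CFC.sqrt_le_sqrt (P * P) A (hP.mul_self_le.trans hA)
  rwa [CFC.sqrt_mul_self P hP.1.nonneg] at h

/-- The Hayashi–Nagaoka operator inequality. -/
theorem hayashi_nagaoka {P A : Matrix S S ℂ} (hP : IsEffect P) (hPA : P ≤ A) (hA : A.PosDef)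
    {c : ℝ} (hc : 0 < c) :
    1 - (CFC.sqrt A)⁻¹ * P * (CFC.sqrt A)⁻¹ ≤
      (1 + c) • (1 - P) + (2 + c + c⁻¹) • (A - P) := by
  have hA0 : 0 ≤ A := hA.posSemidef.nonneg
  set Y := CFC.sqrt A with hY
  have hYA : Y * Y = A := CFC.sqrt_mul_sqrt_self A hA0
  have hY0 : Y.PosSemidef := Matrix.nonneg_iff_posSemidef.1 (CFC.sqrt_nonneg A)
  have hdet : IsUnit Y.det := by
    have := (Matrix.isUnit_iff_isUnit_det _).1 hA.isUnit
    rw [← hYA, Matrix.det_mul] at this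
    exact isUnit_of_mul_isUnit_left this
  set R := Y⁻¹ with hR
  have hRY : R * Y = 1 := Matrix.nonsing_inv_mul Y hdet
  have hYR : Y * R = 1 := Matrix.mul_nonsing_inv Y hdet
  have hRh : R.IsHermitian := hY0.1.inv
  set T := A - P with hT
  have hT0 : T.PosSemidef := Matrix.le_iff.1 hPA
  have hRAR : R * A * R = 1 := by
    rw [← hYA, ← mul_assoc, hRY, one_mul, hYR]
  have hRA : R * A = Y := by rw [← hYA, ← mul_assoc, hRY, one_mul]
  have hAR : A * R = Y := by rw [← hYA, mul_assoc, hYR, mul_one]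
  have hQ : (R - 1).IsHermitian := hRh.sub Matrix.isHermitian_one
  have s1 := (hT0.conjTranspose_mul_mul_same (c⁻¹ • 1 - (R - 1)))
  have hQ' : (c⁻¹ • (1 : Matrix S S ℂ) - (R - 1)).IsHermitian :=
    (Matrix.isHermitian_one.smul (IsSelfAdjoint.all c⁻¹)).sub hQ
  rw [hQ'.eq] at s1
  have s2 := hP.1.conjTranspose_mul_mul_same (R - 1)
  rw [hQ.eq] at s2
  have s3 : (Y - P).PosSemidef := Matrix.le_iff.1 (hP.le_sqrt hPA)
  have hc' : 0 ≤ 1 + c := by linarith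
  -- The gap is a sum of three positive terms. The shift by `c⁻¹` completes the square, absorbing
  -- the cross terms `(R - 1) * T + T * (R - 1)`.
  have key : (1 + c) • (1 - P) + (2 + c + c⁻¹) • T - (1 - R * P * R) =
      c • ((c⁻¹ • 1 - (R - 1)) * T * (c⁻¹ • 1 - (R - 1))) +
        ((1 + c) • ((R - 1) * P * (R - 1)) + ((1 + c) * 2) • (Y - P)) := by
    have e1 : 1 - R * P * R = R * T * R := by
      rw [hT, mul_sub, sub_mul, hRAR]
    have e2 : (R - 1) * P * (R - 1) = (1 - (2 : ℝ) • Y + A) - (R - 1) * T * (R - 1) := by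
      have : (R - 1) * P * (R - 1) = (R - 1) * A * (R - 1) - (R - 1) * T * (R - 1) := by
        rw [hT]; noncomm_ring
      rw [this]
      congr 1
      have : (R - 1) * A * (R - 1) = R * A * R - R * A - A * R + A := by noncomm_ring
      rw [this, hRAR, hRA, hAR, two_smul]
      abel
    have e3 : (c⁻¹ • 1 - (R - 1)) * T * (c⁻¹ • 1 - (R - 1)) =
        (c⁻¹ * c⁻¹) • T - c⁻¹ • ((R - 1) * T + T * (R - 1)) + (R - 1) * T * (R - 1) := by
      simp only [sub_mul, mul_sub, smul_mul_assoc, mul_smul_comm, one_mul, mul_one]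
      module
    have e4 : P = A - T := by rw [hT]; abel
    rw [e1, e2, e3, e4]
    have e5 : R * T * R = T + ((R - 1) * T + T * (R - 1)) + (R - 1) * T * (R - 1) := by
      noncomm_ring
    rw [e5]
    generalize (R - 1) * T + T * (R - 1) = U
    generalize (R - 1) * T * (R - 1) = V
    match_scalars <;> field_simp <;> ring
  rw [Matrix.le_iff, key]
  exact (s1.smul hc.le).add ((s2.smul hc').add (s3.smul (by positivity)))

theorem trace_one_sub_mul {P σ : Matrix S S ℂ} (hσ : σ.trace = 1) :
    ((1 - P) * σ).trace.re = 1 - (P * σ).trace.re := by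
  rw [sub_mul, one_mul, Matrix.trace_sub, hσ, Complex.sub_re, Complex.one_re]

theorem IsEffect.trace_mul_nonneg {P σ : Matrix S S ℂ} (hP : IsEffect P) (hσ : σ.PosSemidef) :
    0 ≤ (P * σ).trace.re := trace_mul_re_nonneg hP.1 hσ

theorem IsEffect.trace_mul_le_one {P σ : Matrix S S ℂ} (hP : IsEffect P) (hσ : IsState σ) :
    (P * σ).trace.re ≤ 1 := by
  have := trace_mul_re_nonneg hP.2 hσ.1
  rw [trace_one_sub_mul hσ.2] at this
  linarith

/-- The regularised pretty good measurement built from effects `Q i`. -/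
theorem exists_decoder {ι : Type*} [Fintype ι] [DecidableEq ι] (Q : ι → Matrix S S ℂ)
    (hQ : ∀ i, IsEffect (Q i)) {δ : ℝ} (hδ : 0 < δ) {c : ℝ} (hc : 0 < c) :
    ∃ D : ι → Matrix S S ℂ, (∀ i, (D i).PosSemidef) ∧ (1 - ∑ i, D i).PosSemidef ∧
      ∀ i σ, IsState σ → 1 - (D i * σ).trace.re ≤
        (1 + c) * (1 - (Q i * σ).trace.re) +
          (2 + c + c⁻¹) * (∑ j ∈ Finset.univ.erase i, (Q j * σ).trace.re + δ) := by
  -- The term `δ • 1` makes the square root invertible; the effects then miss the identity by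
  -- exactly `δ • A⁻¹`, which is positive.
  set A : Matrix S S ℂ := ∑ i, Q i + δ • 1 with hA
  have hsum : (∑ i, Q i).PosSemidef := Matrix.posSemidef_sum _ fun i _ => (hQ i).1
  have hApd : A.PosDef :=
    Matrix.PosDef.posSemidef_add hsum (Matrix.PosDef.one.smul hδ)
  have hYA : CFC.sqrt A * CFC.sqrt A = A := CFC.sqrt_mul_sqrt_self A hApd.posSemidef.nonneg
  have hY0 : (CFC.sqrt A).PosSemidef := Matrix.nonneg_iff_posSemidef.1 (CFC.sqrt_nonneg A)
  have hdet : IsUnit (CFC.sqrt A).det := by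
    have := (Matrix.isUnit_iff_isUnit_det _).1 hApd.isUnit
    rw [← hYA, Matrix.det_mul] at this
    exact isUnit_of_mul_isUnit_left this
  have hRh : ((CFC.sqrt A)⁻¹).IsHermitian := hY0.1.inv
  have hRAR : (CFC.sqrt A)⁻¹ * A * (CFC.sqrt A)⁻¹ = 1 := by
    nth_rewrite 2 [← hYA]
    rw [← mul_assoc, Matrix.nonsing_inv_mul _ hdet, one_mul, Matrix.mul_nonsing_inv _ hdet]
  refine ⟨fun i => (CFC.sqrt A)⁻¹ * Q i * (CFC.sqrt A)⁻¹, fun i => ?_, ?_, fun i σ hσ => ?_⟩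
  · have := (hQ i).1.conjTranspose_mul_mul_same (CFC.sqrt A)⁻¹
    rwa [hRh.eq] at this
  · have := (Matrix.PosSemidef.one (n := S) (R := ℂ)).conjTranspose_mul_mul_same (CFC.sqrt A)⁻¹
    rw [hRh.eq] at this
    rw [← Finset.sum_mul, ← Finset.mul_sum]
    nth_rewrite 1 [← hRAR]
    rw [hA, mul_add, add_mul, add_sub_cancel_left, mul_smul_comm, smul_mul_assoc, ← hA]
    exact this.smul hδ.le
  · have hsplit : A - Q i = ∑ j ∈ Finset.univ.erase i, Q j + δ • 1 := by
      rw [hA, ← Finset.add_sum_erase _ _ (Finset.mem_univ i)]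
      abel
    have hle : Q i ≤ A := by
      rw [Matrix.le_iff, hsplit]
      exact (Matrix.posSemidef_sum _ fun i _ => (hQ i).1).add
        (Matrix.PosSemidef.one.smul hδ.le)
    have h := trace_mul_re_mono hσ.1 (hayashi_nagaoka (hQ i) hle hApd hc)
    rw [Matrix.trace_mul_comm σ (1 - _), trace_one_sub_mul hσ.2,
      Matrix.trace_mul_comm σ (_ + _), add_mul, hsplit,
      Matrix.trace_add, Complex.add_re, smul_mul_assoc, smul_mul_assoc, Matrix.trace_smul,
      Matrix.trace_smul, Complex.smul_re, Complex.smul_re, trace_one_sub_mul hσ.2, add_mul,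
      Finset.sum_mul, Matrix.trace_add, Matrix.trace_sum, smul_mul_assoc, one_mul,
      Matrix.trace_smul, hσ.2, Complex.add_re, Complex.re_sum] at h
    simpa using h

end HayashiNagaoka

noncomputable section

/-! ### Expectations over independent letters -/

section Expectation

variable {X : Type*} [Fintype X]

/-- Expectation of `F` for a family of independent letters with distribution `p`. -/
def expect {ι : Type*} [Fintype ι] [DecidableEq ι] (p : X → ℝ) (F : (ι → X) → ℝ) : ℝ :=
  ∑ x, (∏ i, p (x i)) * F x

variable {ι κ : Type*} [Fintype ι] [DecidableEq ι] [Fintype κ] [DecidableEq κ] {p : X → ℝ}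

theorem IsProb.sum_prod (hp : IsProb p) : ∑ x : ι → X, ∏ i, p (x i) = 1 := by
  rw [← Fintype.prod_sum (fun (_ : ι) (y : X) => p y)]
  simp [hp.2]

theorem expect_const (hp : IsProb p) (r : ℝ) : expect p (fun _ : ι → X => r) = r := by
  rw [expect, ← Finset.sum_mul, hp.sum_prod, one_mul]

theorem expect_mono (hp : IsProb p) {F G : (ι → X) → ℝ} (h : ∀ x, F x ≤ G x) :
    expect p F ≤ expect p G :=
  Finset.sum_le_sum fun x _ =>
    mul_le_mul_of_nonneg_left (h x) (Finset.prod_nonneg fun _ _ => hp.1 _)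

theorem expect_add (F G : (ι → X) → ℝ) :
    expect p (fun x => F x + G x) = expect p F + expect p G := by
  simp [expect, mul_add, Finset.sum_add_distrib]

theorem expect_mul_left (r : ℝ) (F : (ι → X) → ℝ) :
    expect p (fun x => r * F x) = r * expect p F := by
  simp only [expect, Finset.mul_sum]
  exact Finset.sum_congr rfl fun x _ => by ring

theorem expect_sum {α : Type*} (s : Finset α) (F : α → (ι → X) → ℝ) :
    expect p (fun x => ∑ a ∈ s, F a x) = ∑ a ∈ s, expect p (F a) := by
  simp only [expect, Finset.mul_sum]
  rw [Finset.sum_comm]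

theorem exists_le_expect (hp : IsProb p) (F : (ι → X) → ℝ) : ∃ x, F x ≤ expect p F := by
  by_contra! h
  have h1 : expect p (fun _ : ι → X => expect p F) < expect p F := by
    have hne : ∃ x : ι → X, 0 < ∏ i, p (x i) := by
      by_contra! h0
      have := hp.sum_prod (ι := ι)
      have : ∑ x : ι → X, ∏ i, p (x i) ≤ 0 := Finset.sum_nonpos fun x _ => h0 x
      linarith
    obtain ⟨x, hx⟩ := hne
    exact Finset.sum_lt_sum
      (fun x _ => mul_le_mul_of_nonneg_left (h x).le (Finset.prod_nonneg fun _ _ => hp.1 _))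
      ⟨x, Finset.mem_univ _, mul_lt_mul_of_pos_left (h x) hx⟩
  rw [expect_const hp] at h1
  exact lt_irrefl _ h1

/-- The letters at the positions `e k` are again independent with distribution `p`. -/
theorem expect_comp_injective (hp : IsProb p) {e : κ → ι} (he : Function.Injective e)
    (F : (κ → X) → ℝ) : expect p (fun x : ι → X => F (x ∘ e)) = expect p F := by
  classical
  obtain ⟨q, eq1, heq⟩ : ∃ (q : ι → Prop) (eq1 : κ ≃ {i // q i}), ∀ k, (eq1 k : ι) = e k :=
    ⟨fun i => i ∈ Set.range e, Equiv.ofInjective e he, fun _ => rfl⟩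
  -- The positions are split into the range of `e` and its complement; the weights on the complement
  -- sum to one.
  rw [expect, ← (Equiv.piEquivPiSubtypeProd q (fun _ => X)).symm.sum_comp, Fintype.sum_prod_type,
    expect, ← (eq1.arrowCongr (Equiv.refl X)).symm.sum_comp]
  refine Finset.sum_congr rfl fun y _ => ?_
  have hF : ∀ z : {i // ¬ q i} → X,
      ((Equiv.piEquivPiSubtypeProd q (fun _ => X)).symm (y, z)) ∘ e =
        (eq1.arrowCongr (Equiv.refl X)).symm y := by
    intro z
    funext k
    simp [Equiv.piEquivPiSubtypeProd, Equiv.arrowCongr, ← heq, (eq1 k).2]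
  have hw : ∀ z : {i // ¬ q i} → X,
      ∏ i, p ((Equiv.piEquivPiSubtypeProd q (fun _ => X)).symm (y, z) i) =
        (∏ k, p ((eq1.arrowCongr (Equiv.refl X)).symm y k)) * ∏ i, p (z i) := by
    intro z
    rw [← Fintype.prod_subtype_mul_prod_subtype q]
    congr 1
    · symm
      refine Fintype.prod_equiv (M := ℝ) eq1
        (fun k => p ((eq1.arrowCongr (Equiv.refl X)).symm y k)) _ fun k => ?_
      rw [heq]
      exact congrArg p (congrFun (hF z) k).symm
    · refine Finset.prod_congr rfl fun i _ => ?_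
      simp [Equiv.piEquivPiSubtypeProd, i.2]
  simp_rw [hF, hw]
  rw [← Finset.sum_mul, ← Finset.mul_sum, hp.sum_prod, mul_one]

theorem expect_apply (hp : IsProb p) (i : ι) (f : X → ℝ) :
    expect p (fun x : ι → X => f (x i)) = ∑ y, p y * f y := by
  refine (expect_comp_injective hp (e := fun _ : Unit => i) (fun _ _ _ => rfl)
    (fun x => f (x ()))).trans ?_
  rw [expect, ← (Equiv.funUnique Unit X).symm.sum_comp]
  simp

theorem expect_apply₂ (hp : IsProb p) {i j : ι} (hij : i ≠ j) (f : X → X → ℝ) :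
    expect p (fun x : ι → X => f (x i) (x j)) = ∑ y, ∑ z, p y * p z * f y z := by
  have he : Function.Injective (fun k : Fin 2 => if k = 0 then i else j) := by
    intro a b h
    fin_cases a <;> fin_cases b <;> simp_all
  have := expect_comp_injective hp he (fun x => f (x 0) (x 1))
  simp only [Function.comp_apply, if_true, one_ne_zero, if_false] at this
  rw [this, expect, ← (finTwoArrowEquiv X).symm.sum_comp, Fintype.sum_prod_type]
  simp [Fin.prod_univ_two]

/-- Variance of an empirical mean with respect to a positive bilinear form. -/
theorem expect_empirical_variance_le (hp : IsProb p) {V : Type*} [AddCommGroup V] [Module ℝ V]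
    (B : V →ₗ[ℝ] V →ₗ[ℝ] ℝ) (hB : ∀ v, 0 ≤ B v v) (a : X → V) {K : ℕ} (hK : 0 < K) :
    expect p (fun x : Fin K → X =>
      B ((K : ℝ)⁻¹ • ∑ k, a (x k) - ∑ y, p y • a y) ((K : ℝ)⁻¹ • ∑ k, a (x k) - ∑ y, p y • a y)) ≤
      (K : ℝ)⁻¹ * ∑ y, p y * B (a y) (a y) := by
  have hK' : (0 : ℝ) < K := by exact_mod_cast hK
  set m := ∑ y, p y • a y with hm
  set b : X → V := fun y => a y - m with hb
  have hb0 : ∑ y, p y • b y = 0 := by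
    simp only [hb, smul_sub, Finset.sum_sub_distrib, ← Finset.sum_smul, hp.2, one_smul]
    rw [← hm, sub_self]
  have hD : ∀ x : Fin K → X, (K : ℝ)⁻¹ • ∑ k, a (x k) - m = (K : ℝ)⁻¹ • ∑ k, b (x k) := by
    intro x
    simp only [hb, Finset.sum_sub_distrib, smul_sub, Finset.sum_const, Finset.card_univ,
      Fintype.card_fin]
    rw [← Nat.cast_smul_eq_nsmul ℝ, smul_smul, inv_mul_cancel₀ hK'.ne', one_smul]
  have hBB : ∀ x : Fin K → X, B ((K : ℝ)⁻¹ • ∑ k, a (x k) - m) ((K : ℝ)⁻¹ • ∑ k, a (x k) - m) =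
      ((K : ℝ)⁻¹ * (K : ℝ)⁻¹) * ∑ k, ∑ l, B (b (x k)) (b (x l)) := by
    intro x
    rw [hD]
    simp only [map_smul, LinearMap.smul_apply, smul_eq_mul, map_sum, LinearMap.sum_apply]
    rw [← Finset.mul_sum, mul_assoc, Finset.sum_comm]
  -- After centring, distinct positions are uncorrelated and only the `K` diagonal terms survive.
  have hpair : ∀ k l : Fin K, expect p (fun x : Fin K → X => B (b (x k)) (b (x l))) =
      if k = l then ∑ y, p y * B (b y) (b y) else 0 := by
    intro k l
    split_ifs with h
    · subst h
      exact expect_apply hp k (fun y => B (b y) (b y))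
    · rw [expect_apply₂ hp h (fun y z => B (b y) (b z))]
      have : B (∑ y, p y • b y) (∑ z, p z • b z) = 0 := by rw [hb0]; simp
      simp only [map_sum, map_smul, LinearMap.sum_apply, LinearMap.smul_apply, smul_eq_mul] at this
      rw [← this, Finset.sum_comm]
      refine Finset.sum_congr rfl fun y _ => ?_
      rw [Finset.mul_sum]
      exact Finset.sum_congr rfl fun z _ => by ring
  have hvar : ∑ y, p y * B (b y) (b y) ≤ ∑ y, p y * B (a y) (a y) := by
    have h1 : ∑ y, p y * B (b y) (b y) = ∑ y, p y * B (a y) (a y) - B m m := by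
      have e1 : ∑ y, p y * B (a y) m = B m m := by
        nth_rewrite 2 [hm]
        simp [map_sum]
      have e2 : ∑ y, p y * B m (a y) = B m m := by
        nth_rewrite 3 [hm]
        simp [map_sum]
      have e3 : ∑ y, p y * B m m = B m m := by rw [← Finset.sum_mul, hp.2, one_mul]
      have : ∀ y, p y * B (b y) (b y) =
          p y * B (a y) (a y) - p y * B (a y) m - (p y * B m (a y) - p y * B m m) := by
        intro y
        simp only [hb, map_sub, LinearMap.sub_apply]
        ring
      simp only [this, Finset.sum_sub_distrib, e1, e2, e3]
      ring
    linarith [hB m]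
  simp only [hBB]
  rw [expect_mul_left, expect_sum]
  simp only [expect_sum, hpair]
  simp only [Finset.sum_ite_eq, Finset.mem_univ, if_true, Finset.sum_const, Finset.card_univ,
    Fintype.card_fin, nsmul_eq_mul]
  calc (K : ℝ)⁻¹ * (K : ℝ)⁻¹ * (K * ∑ y, p y * B (b y) (b y))
      = (K : ℝ)⁻¹ * ∑ y, p y * B (b y) (b y) := by field_simp
    _ ≤ _ := mul_le_mul_of_nonneg_left hvar (by positivity)

end Expectation

/-! ### Quantum covering in second moment -/

section Covering
open scoped MatrixOrder

variable {S : Type*} [Fintype S] [DecidableEq S]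

/-- Cauchy–Schwarz for the form weighted by `τ`, together with `P * P ≤ 1`. With `P` optimal for `D`
it bounds the trace norm by a quadratic form, to which variance computations apply. -/
theorem trace_mul_sq_le {τ P D : Matrix S S ℂ} (hτ : τ.PosDef) (hP : P.IsHermitian)
    (h1 : (1 - P).PosSemidef) (h2 : (1 + P).PosSemidef) (hD : D.IsHermitian) :
    (P * D).trace.re ^ 2 ≤ τ.trace.re * (D * τ⁻¹ * D).trace.re := by
  have hdet : IsUnit τ.det := (Matrix.isUnit_iff_isUnit_det _).1 hτ.isUnit
  have hti : τ⁻¹.IsHermitian := hτ.1.inv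
  have hPP : (1 - P * P).PosSemidef := by
    have e : (2 : ℝ) • (1 - P * P) =
        (1 - P)ᴴ * (1 + P) * (1 - P) + (1 + P)ᴴ * (1 - P) * (1 + P) := by
      rw [h1.1.eq, h2.1.eq, two_smul]; noncomm_ring
    have := ((h2.conjTranspose_mul_mul_same (1 - P)).add
      (h1.conjTranspose_mul_mul_same (1 + P)))
    rw [← e] at this
    have h := this.smul (show (0 : ℝ) ≤ 2⁻¹ by norm_num)
    rwa [smul_smul, inv_mul_cancel₀ two_ne_zero, one_smul] at h
  have hle : (P * τ * P).trace.re ≤ τ.trace.re := by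
    have := trace_mul_re_nonneg hτ.posSemidef hPP
    rw [mul_sub, mul_one, Matrix.trace_sub, Complex.sub_re, ← mul_assoc,
      Matrix.trace_mul_comm (τ * P) P, ← mul_assoc] at this
    linarith
  -- The quadratic is the squared weighted length of `P - u • (τ⁻¹ * D)`; Cauchy–Schwarz is the sign
  -- of its discriminant.
  have hquad : ∀ u : ℝ, 0 ≤ (D * τ⁻¹ * D).trace.re * (u * u) + (-2 * (P * D).trace.re) * u +
      (P * τ * P).trace.re := by
    intro u
    have h := trace_re_nonneg (hτ.posSemidef.conjTranspose_mul_mul_same (P - u • (τ⁻¹ * D)))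
    have e : (P - u • (τ⁻¹ * D))ᴴ * τ * (P - u • (τ⁻¹ * D)) =
        P * τ * P - u • (P * D) - u • (D * P) + (u * u) • (D * τ⁻¹ * D) := by
      rw [Matrix.conjTranspose_sub, Matrix.conjTranspose_smul, Matrix.conjTranspose_mul, hP.eq,
        hD.eq, hti.eq, star_trivial]
      have i1 : P * τ * (τ⁻¹ * D) = P * D := by
        rw [← mul_assoc, mul_assoc P, Matrix.mul_nonsing_inv _ hdet, mul_one]
      have i2 : D * τ⁻¹ * τ = D := by rw [mul_assoc, Matrix.nonsing_inv_mul _ hdet, mul_one]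
      have i3 : D * (τ⁻¹ * D) = D * τ⁻¹ * D := by rw [mul_assoc]
      simp only [sub_mul, mul_sub, smul_mul_assoc, mul_smul_comm, i1, i2, i3]
      module
    rw [e] at h
    simp only [Matrix.trace_add, Matrix.trace_sub, Matrix.trace_smul, Complex.add_re,
      Complex.sub_re, Complex.smul_re, smul_eq_mul, Matrix.trace_mul_comm D P] at h
    linarith
  have hd := discrim_le_zero hquad
  rw [discrim] at hd
  have hDD : 0 ≤ (D * τ⁻¹ * D).trace.re := by
    have := hτ.inv.posSemidef.conjTranspose_mul_mul_same D
    rw [hD.eq] at this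
    exact trace_re_nonneg this
  nlinarith [mul_le_mul_of_nonneg_right hle hDD]

/-- With `V` the inverse of `l • τ`, the difference `a - a * V * a` is a sum of two congruences, of
`a` and of `l • τ - a`, hence positive. -/
theorem trace_mul_inv_mul_le {τ a : Matrix S S ℂ} (hτ : τ.PosDef) (ha : a.PosSemidef) {l : ℝ}
    (hl : 0 < l) (hal : a ≤ l • τ) : (a * τ⁻¹ * a).trace.re ≤ l * a.trace.re := by
  have hdet : IsUnit τ.det := (Matrix.isUnit_iff_isUnit_det _).1 hτ.isUnit
  have hti : τ⁻¹.IsHermitian := hτ.1.inv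
  set V : Matrix S S ℂ := l⁻¹ • τ⁻¹ with hV
  have hVh : V.IsHermitian := hti.smul (IsSelfAdjoint.all l⁻¹)
  have hVτ : V * (l • τ) = 1 := by
    rw [hV, smul_mul_smul_comm, inv_mul_cancel₀ hl.ne', Matrix.nonsing_inv_mul _ hdet, one_smul]
  have hc := Matrix.le_iff.1 hal
  have s1 := ha.conjTranspose_mul_mul_same (1 - V * a)
  have s2 := hc.conjTranspose_mul_mul_same (V * a)
  have e : a - a * V * a = (1 - V * a)ᴴ * a * (1 - V * a) + (V * a)ᴴ * (l • τ - a) * (V * a) := by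
    rw [Matrix.conjTranspose_sub, Matrix.conjTranspose_mul, ha.1.eq, hVh.eq,
      Matrix.conjTranspose_one]
    have : a * V * (l • τ - a) * (V * a) = a * (V * (l • τ)) * V * a - a * V * a * V * a := by
      noncomm_ring
    rw [this, hVτ]
    noncomm_ring
  have h := trace_re_nonneg (s1.add s2)
  rw [← e, hV, mul_smul_comm, smul_mul_assoc, Matrix.trace_sub, Matrix.trace_smul, Complex.sub_re,
    Complex.smul_re, smul_eq_mul] at h
  have : l * (l⁻¹ * (a * τ⁻¹ * a).trace.re) ≤ l * a.trace.re :=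
    mul_le_mul_of_nonneg_left (by linarith) hl.le
  rwa [← mul_assoc, mul_inv_cancel₀ hl.ne', one_mul] at this

/-- The real bilinear form `Re Tr (Aᴴ W C)`. -/
def traceForm (W : Matrix S S ℂ) : Matrix S S ℂ →ₗ[ℝ] Matrix S S ℂ →ₗ[ℝ] ℝ :=
  LinearMap.mk₂ ℝ (fun A C => (Aᴴ * W * C).trace.re)
    (fun A A' C => by simp [Matrix.add_mul, Matrix.trace_add])
    (fun r A C => by simp [Matrix.conjTranspose_smul, Matrix.trace_smul])
    (fun A C C' => by simp [Matrix.mul_add, Matrix.trace_add])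
    (fun r A C => by simp [Matrix.trace_smul])

theorem traceForm_apply (W A C : Matrix S S ℂ) : traceForm W A C = (Aᴴ * W * C).trace.re := rfl

/-- Quantum covering: an empirical average of operators dominated by `l • τ` is close in trace norm
to its mean, in second moment. -/
theorem expect_traceNorm_sq_le {X : Type*} [Fintype X] {p : X → ℝ} (hp : IsProb p)
    {τ : Matrix S S ℂ} (hτ : IsState τ) {a : X → Matrix S S ℂ} (ha : ∀ x, (a x).PosSemidef)
    {l : ℝ} (hl : 0 < l) (hal : ∀ x, a x ≤ l • τ) (htr : ∑ x, p x * (a x).trace.re ≤ 1)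
    {K : ℕ} (hK : 0 < K) :
    expect p (fun x : Fin K → X =>
      traceNorm ((K : ℝ)⁻¹ • ∑ k, a (x k) - ∑ y, p y • a y) ^ 2) ≤ 2 * l / K := by
  have hK' : (0 : ℝ) < K := by exact_mod_cast hK
  -- Small enough that the regularisation adds at most one to the trace; this is how the dimension
  -- drops out.
  set δ : ℝ := ((Fintype.card S : ℝ) + 1)⁻¹ with hδ
  have hδ0 : 0 < δ := by positivity
  set τ' := τ + δ • (1 : Matrix S S ℂ) with hτ'
  have hpd : τ'.PosDef := Matrix.PosDef.posSemidef_add hτ.1 (Matrix.PosDef.one.smul hδ0)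
  have htr' : τ'.trace.re ≤ 2 := by
    rw [hτ', Matrix.trace_add, hτ.2, Matrix.trace_smul, Matrix.trace_one]
    simp only [Complex.add_re, Complex.one_re, Complex.smul_re, Complex.natCast_re, smul_eq_mul]
    have : δ * (Fintype.card S : ℝ) ≤ 1 := by
      rw [hδ, inv_mul_le_iff₀ (by positivity)]
      linarith
    linarith
  have hal' : ∀ x, a x ≤ l • τ' := fun x => by
    have h := (Matrix.le_iff.1 (hal x)).add
      ((Matrix.PosSemidef.one (n := S) (R := ℂ)).smul (mul_pos hl hδ0).le)
    rw [Matrix.le_iff]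
    convert h using 1
    rw [hτ', smul_add, smul_smul]
    abel
  have hsum : ∀ f : X → Matrix S S ℂ, (∀ y, (f y).IsHermitian) → (∑ y, f y).IsHermitian :=
    fun f hf => isSelfAdjoint_sum _ fun y _ => hf y
  have hD : ∀ x : Fin K → X,
      ((K : ℝ)⁻¹ • ∑ k, a (x k) - ∑ y, p y • a y).IsHermitian := fun x =>
    (Matrix.IsHermitian.smul (isSelfAdjoint_sum _ fun k _ => (ha (x k)).1)
      (IsSelfAdjoint.all _)).sub
      (hsum _ fun y => (ha y).1.smul (IsSelfAdjoint.all _))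
  have hB : ∀ v, 0 ≤ traceForm τ'⁻¹ v v := fun v =>
    trace_re_nonneg (hpd.inv.posSemidef.conjTranspose_mul_mul_same v)
  have hpt : ∀ x : Fin K → X, traceNorm ((K : ℝ)⁻¹ • ∑ k, a (x k) - ∑ y, p y • a y) ^ 2 ≤
      2 * traceForm τ'⁻¹ ((K : ℝ)⁻¹ • ∑ k, a (x k) - ∑ y, p y • a y)
        ((K : ℝ)⁻¹ • ∑ k, a (x k) - ∑ y, p y • a y) := by
    intro x
    obtain ⟨P, hP, h1, h2, h⟩ := exists_trace_mul_eq_traceNorm (hD x)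
    rw [← h]
    refine (trace_mul_sq_le hpd hP h1 h2 (hD x)).trans ?_
    have h0 := hB ((K : ℝ)⁻¹ • ∑ k, a (x k) - ∑ y, p y • a y)
    rw [traceForm_apply, (hD x).eq] at h0 ⊢
    exact mul_le_mul_of_nonneg_right htr' h0
  refine (expect_mono hp hpt).trans ?_
  rw [expect_mul_left]
  have hv := expect_empirical_variance_le hp (traceForm τ'⁻¹) hB a hK
  have hs : ∑ y, p y * traceForm τ'⁻¹ (a y) (a y) ≤ l := by
    calc ∑ y, p y * traceForm τ'⁻¹ (a y) (a y) ≤ ∑ y, l * (p y * (a y).trace.re) := by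
          refine Finset.sum_le_sum fun y _ => ?_
          have := trace_mul_inv_mul_le hpd (ha y) hl (hal' y)
          rw [traceForm_apply, (ha y).1.eq]
          nlinarith [mul_le_mul_of_nonneg_left this (hp.1 y)]
      _ ≤ l := by
          rw [← Finset.mul_sum]
          nlinarith
  calc _ ≤ 2 * ((K : ℝ)⁻¹ * l) :=
        mul_le_mul_of_nonneg_left (hv.trans (mul_le_mul_of_nonneg_left hs (by positivity)))
          (by norm_num)
    _ = 2 * l / K := by field_simp

end Covering
end

/-! ### Random codes and expurgation -/

section RandomCoding

/-- Completes a family of positive operators with sum at most one to a POVM. -/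
theorem exists_povm_ge {B : Type*} [Fintype B] [DecidableEq B] {M : ℕ} (hM : 0 < M)
    (D : Fin M → Matrix B B ℂ) (hD : ∀ m, (D m).PosSemidef) (hs : (1 - ∑ m, D m).PosSemidef) :
    ∃ D' : Fin M → Matrix B B ℂ, (∀ m, (D' m).PosSemidef) ∧ ∑ m, D' m = 1 ∧
      ∀ m, (D' m - D m).PosSemidef := by
  refine ⟨fun m => D m + if m = ⟨0, hM⟩ then 1 - ∑ m, D m else 0, fun m => ?_, ?_, fun m => ?_⟩
  · refine (hD m).add ?_
    split_ifs
    exacts [hs, Matrix.PosSemidef.zero]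
  · rw [Finset.sum_add_distrib, Finset.sum_ite_eq' Finset.univ]
    simp
  · rw [add_sub_cancel_left]
    split_ifs
    exacts [hs, Matrix.PosSemidef.zero]

/-- A nonnegative family whose sum is small has many members below `1`. -/
theorem exists_embedding_lt_one {n M : ℕ} (Φ : Fin n → ℝ) (h0 : ∀ m, 0 ≤ Φ m)
    (hs : ∑ m, Φ m ≤ n - M) : ∃ f : Fin M ↪ Fin n, ∀ m, Φ (f m) < 1 := by
  classical
  set G := Finset.univ.filter fun m => Φ m < 1 with hG
  have hbad : ((Finset.univ.filter fun m => ¬ Φ m < 1).card : ℝ) ≤ n - M := by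
    refine le_trans ?_ hs
    calc ((Finset.univ.filter fun m => ¬ Φ m < 1).card : ℝ)
        = ∑ m ∈ Finset.univ.filter (fun m => ¬ Φ m < 1), (1 : ℝ) := by simp
      _ ≤ ∑ m ∈ Finset.univ.filter (fun m => ¬ Φ m < 1), Φ m :=
          Finset.sum_le_sum fun m hm => not_lt.1 (Finset.mem_filter.1 hm).2
      _ ≤ ∑ m, Φ m := Finset.sum_le_sum_of_subset_of_nonneg (Finset.filter_subset _ _)
          fun m _ _ => h0 m
  have hcard : (G.card : ℝ) + (Finset.univ.filter fun m => ¬ Φ m < 1).card = n := by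
    have := Finset.card_filter_add_card_filter_not (s := (Finset.univ : Finset (Fin n)))
      (fun m => Φ m < 1)
    rw [Finset.card_univ, Fintype.card_fin] at this
    exact_mod_cast this
  have hMG : M ≤ G.card := by
    have : (M : ℝ) ≤ G.card := by linarith
    exact_mod_cast this
  refine ⟨(Finset.orderEmbOfCardLe G hMG).toEmbedding, fun m => ?_⟩
  exact (Finset.mem_filter.1 (Finset.orderEmbOfCardLe_mem G hMG m)).2

variable {B X : Type*} [Fintype B] [DecidableEq B] [Fintype X]

/-- Random coding with expurgation: a code in which every message is decoded correctly and
satisfies a side condition `V < 1` that holds on average. -/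
theorem exists_code {p : X → ℝ} (hp : IsProb p) {σ : X → Matrix B B ℂ} (hσ : ∀ x, IsState (σ x))
    {Q : X → Matrix B B ℂ} (hQ : ∀ x, IsEffect (Q x)) {ε q δ e v : ℝ}
    (hε : 1 - ε ≤ ∑ x, p x * (Q x * σ x).trace.re)
    (hq : ∑ x, ∑ y, p x * p y * (Q x * σ y).trace.re ≤ q) (hδ : 0 < δ) (he : 0 < e)
    {K M N : ℕ} (hK : 0 < K) (hM : 0 < M) (hN : 0 < N) (V : (Fin K → X) → ℝ)
    (hV0 : ∀ x, 0 ≤ V x) (hV : expect p V ≤ v)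
    (hnum : (5 / 4 * ε + 25 / 4 * (N * M * K * q + δ)) / e + v ≤ 1 - 1 / N) :
    ∃ (x : Fin M → Fin K → X) (D : Fin M → Matrix B B ℂ),
      (∀ m, (D m).PosSemidef) ∧ ∑ m, D m = 1 ∧
      ∀ m, 1 - (D m * ((K : ℝ)⁻¹ • ∑ k, σ (x m k))).trace.re ≤ e ∧ V (x m) < 1 := by
  classical
  have hK' : (0 : ℝ) < K := by exact_mod_cast hK
  have hM' : (0 : ℝ) < M := by exact_mod_cast hM
  have hN' : (0 : ℝ) < N := by exact_mod_cast hN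
  let g : X → ℝ := fun y => 1 - (Q y * σ y).trace.re
  let r : X → X → ℝ := fun y z => (Q y * σ z).trace.re
  -- Codewords are indexed by candidate message and by the sender's local randomness; the decoder
  -- first looks for the full index.
  let ι := Fin (N * M) × Fin K
  let U : Fin (N * M) → (ι → X) → ℝ := fun m x =>
    (K : ℝ)⁻¹ * ∑ k, (5 / 4 * g (x (m, k)) +
      25 / 4 * (∑ j ∈ Finset.univ.erase (m, k), r (x j) (x (m, k)) + δ))
  -- `Φ < 1` forces both `U < e` and `V < 1`, since both summands are nonnegative.
  let Φ : Fin (N * M) → (ι → X) → ℝ := fun m x => e⁻¹ * U m x + V (x ∘ fun k => (m, k))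
  have hr0 : ∀ y z, 0 ≤ r y z := fun y z => (hQ y).trace_mul_nonneg (hσ z).1
  have hg0 : ∀ y, 0 ≤ g y := fun y => sub_nonneg.2 ((hQ y).trace_mul_le_one (hσ y))
  have hU0 : ∀ m x, 0 ≤ U m x := fun m x => by
    refine mul_nonneg (by positivity) (Finset.sum_nonneg fun k _ => ?_)
    have := hg0 (x (m, k))
    have : 0 ≤ ∑ j ∈ Finset.univ.erase (m, k), r (x j) (x (m, k)) :=
      Finset.sum_nonneg fun j _ => hr0 _ _
    positivity
  have hΦ0 : ∀ m x, 0 ≤ Φ m x := fun m x =>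
    add_nonneg (mul_nonneg (by positivity) (hU0 m x)) (hV0 _)
  have hEg : ∑ y, p y * g y ≤ ε := by
    simp only [g, mul_sub, mul_one, Finset.sum_sub_distrib, hp.2]
    linarith
  have hq0 : 0 ≤ q := le_trans (Finset.sum_nonneg fun y _ => Finset.sum_nonneg fun z _ =>
    mul_nonneg (mul_nonneg (hp.1 y) (hp.1 z)) (hr0 y z)) hq
  have hEU : ∀ m, expect p (U m) ≤ 5 / 4 * ε + 25 / 4 * (N * M * K * q + δ) := by
    intro m
    have hterm : ∀ k, expect p (fun x : ι → X => 5 / 4 * g (x (m, k)) +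
        25 / 4 * (∑ j ∈ Finset.univ.erase (m, k), r (x j) (x (m, k)) + δ)) ≤
        5 / 4 * ε + 25 / 4 * (N * M * K * q + δ) := by
      intro k
      rw [expect_add, expect_mul_left, expect_mul_left, expect_add, expect_const hp, expect_sum,
        expect_apply hp (m, k) g]
      have h1 : ∑ j ∈ Finset.univ.erase (m, k), expect p (fun x : ι → X => r (x j) (x (m, k))) ≤
          N * M * K * q := by
        calc _ ≤ ∑ j ∈ Finset.univ.erase ((m, k) : ι), q := by
              refine Finset.sum_le_sum fun j hj => ?_
              rw [expect_apply₂ hp (Finset.ne_of_mem_erase hj) r]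
              exact hq
          _ ≤ ∑ j : ι, q := Finset.sum_le_sum_of_subset_of_nonneg (Finset.erase_subset _ _)
              fun _ _ _ => hq0
          _ = _ := by simp [ι]
      linarith
    calc expect p (U m) = (K : ℝ)⁻¹ * ∑ k, expect p (fun x : ι → X => 5 / 4 * g (x (m, k)) +
          25 / 4 * (∑ j ∈ Finset.univ.erase (m, k), r (x j) (x (m, k)) + δ)) := by
          rw [← expect_sum, ← expect_mul_left]
      _ ≤ (K : ℝ)⁻¹ * ∑ _k : Fin K, (5 / 4 * ε + 25 / 4 * (N * M * K * q + δ)) :=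
          mul_le_mul_of_nonneg_left (Finset.sum_le_sum fun k _ => hterm k) (by positivity)
      _ = _ := by
          rw [Finset.sum_const, Finset.card_univ, Fintype.card_fin, nsmul_eq_mul]
          field_simp
  have hEΦ : ∀ m, expect p (Φ m) ≤ 1 - 1 / N := by
    intro m
    have hinj : Function.Injective fun k : Fin K => ((m, k) : ι) := fun a b h =>
      (Prod.ext_iff.1 h).2
    have : expect p (Φ m) = e⁻¹ * expect p (U m) + expect p V := by
      rw [← expect_comp_injective hp hinj V, ← expect_mul_left, ← expect_add]
    rw [this]
    refine le_trans ?_ hnum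
    rw [div_eq_inv_mul]
    exact add_le_add (mul_le_mul_of_nonneg_left (hEU m) (by positivity)) hV
  obtain ⟨x, hx⟩ := exists_le_expect hp (fun x : ι → X => ∑ m, Φ m x)
  have hsum : ∑ m, Φ m x ≤ ((N * M : ℕ) : ℝ) - M := by
    refine hx.trans ?_
    rw [expect_sum]
    calc _ ≤ ∑ _m : Fin (N * M), (1 - 1 / (N : ℝ)) := Finset.sum_le_sum fun m _ => hEΦ m
      _ = _ := by
        rw [Finset.sum_const, Finset.card_univ, Fintype.card_fin, nsmul_eq_mul]
        push_cast
        field_simp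
  obtain ⟨f, hf⟩ := exists_embedding_lt_one (fun m => Φ m x) (fun m => hΦ0 m x) hsum
  -- The choice `c = 1 / 4` yields the coefficients `5 / 4` and `25 / 4` used in `U`.
  obtain ⟨D, hD0, hD1, hD⟩ := exists_decoder (fun j : ι => Q (x j)) (fun j => hQ _) hδ
    (c := 1 / 4) (by norm_num)
  have hsub : (1 - ∑ m : Fin M, ∑ k : Fin K, D (f m, k)).PosSemidef := by
    have hall : ∑ j : ι, D j = ∑ m, ∑ k, D (m, k) := Fintype.sum_prod_type _
    have himg : ∑ m : Fin M, ∑ k : Fin K, D (f m, k) =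
        ∑ m ∈ Finset.univ.map f, ∑ k : Fin K, D (m, k) := by rw [Finset.sum_map]
    have hcompl : ∑ m, ∑ k, D (m, k) = ∑ m ∈ Finset.univ.map f, ∑ k : Fin K, D (m, k) +
        ∑ m ∈ (Finset.univ.map f)ᶜ, ∑ k : Fin K, D (m, k) :=
      (Finset.sum_add_sum_compl _ _).symm
    rw [hall, hcompl, ← himg] at hD1
    have h2 : (∑ m ∈ (Finset.univ.map f)ᶜ, ∑ k : Fin K, D (m, k)).PosSemidef :=
      Matrix.posSemidef_sum _ fun m _ => Matrix.posSemidef_sum _ fun k _ => hD0 _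
    have := hD1.add h2
    rwa [sub_add_eq_sub_sub, sub_add_cancel] at this
  obtain ⟨D', hD'0, hD'1, hD'⟩ := exists_povm_ge hM (fun m => ∑ k : Fin K, D (f m, k))
    (fun m => Matrix.posSemidef_sum _ fun k _ => hD0 _) hsub
  refine ⟨fun m k => x (f m, k), D', hD'0, hD'1, fun m => ?_⟩
  have hV1 : V (fun k => x (f m, k)) = V (x ∘ fun k => (f m, k)) := rfl
  have hfm := hf m
  simp only [Φ] at hfm
  have hUe : U (f m) x < e := by
    have h1 : e⁻¹ * U (f m) x < 1 := by linarith [hV0 (x ∘ fun k => (f m, k))]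
    rwa [inv_mul_lt_iff₀ he, mul_one] at h1
  refine ⟨le_trans ?_ hUe.le, ?_⟩
  · have hk : ∀ k, 1 - (D' m * σ (x (f m, k))).trace.re ≤ 5 / 4 * g (x (f m, k)) +
        25 / 4 * (∑ j ∈ Finset.univ.erase (f m, k), r (x j) (x (f m, k)) + δ) := by
      intro k
      have h1 := hD (f m, k) _ (hσ (x (f m, k)))
      -- Recognising any codeword of the right message is enough, so the decoder of `m` dominates
      -- that of each of its codewords.
      have h2 : ((D' m - D (f m, k))).PosSemidef := by
        have h3 : (∑ k' ∈ Finset.univ.erase k, D (f m, k')).PosSemidef :=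
          Matrix.posSemidef_sum _ fun k _ => hD0 _
        have := (hD' m).add h3
        convert this using 1
        rw [← Finset.add_sum_erase _ _ (Finset.mem_univ k)]
        abel
      have h4 := trace_mul_re_nonneg h2 (hσ (x (f m, k))).1
      rw [sub_mul, Matrix.trace_sub, Complex.sub_re] at h4
      rw [show (1 : ℝ) + 1 / 4 = 5 / 4 by norm_num,
        show (2 : ℝ) + 1 / 4 + (1 / 4)⁻¹ = 25 / 4 by norm_num] at h1
      simp only [g, r]
      linarith
    have hav : 1 - (D' m * ((K : ℝ)⁻¹ • ∑ k, σ (x (f m, k)))).trace.re =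
        (K : ℝ)⁻¹ * ∑ k, (1 - (D' m * σ (x (f m, k))).trace.re) := by
      rw [mul_smul_comm, Matrix.trace_smul, Complex.smul_re, Finset.mul_sum, Matrix.trace_sum,
        Complex.re_sum, Finset.sum_sub_distrib, mul_sub, Finset.sum_const, Finset.card_univ,
        Fintype.card_fin, nsmul_eq_mul, mul_one, inv_mul_cancel₀ hK'.ne', smul_eq_mul]
    rw [hav]
    exact mul_le_mul_of_nonneg_left (Finset.sum_le_sum fun k _ => hk k) (by positivity)
  · rw [hV1]
    linarith [mul_nonneg (inv_nonneg.2 he.le) (hU0 (f m) x)]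

end RandomCoding

noncomputable section

/-! ### Block-diagonal matrices and pinching -/

section Blocks
open scoped MatrixOrder

variable {X S : Type*}

/-- The diagonal block at `x` of a matrix on a product system. -/
def block (M : Matrix (X × S) (X × S) ℂ) (x : X) : Matrix S S ℂ :=
  M.submatrix (Prod.mk x) (Prod.mk x)

/-- The block-diagonal matrix with given blocks. -/
def ofBlocks [Fintype X] [DecidableEq X] (f : X → Matrix S S ℂ) : Matrix (X × S) (X × S) ℂ :=
  ∑ x, Matrix.single x x (1 : ℂ) ⊗ₖ f x

theorem block_apply (M : Matrix (X × S) (X × S) ℂ) (x : X) (s s' : S) :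
    block M x s s' = M (x, s) (x, s') := rfl

theorem block_sub (M N : Matrix (X × S) (X × S) ℂ) (x : X) :
    block (M - N) x = block M x - block N x := rfl

theorem block_posSemidef {M : Matrix (X × S) (X × S) ℂ} (hM : M.PosSemidef) (x : X) :
    (block M x).PosSemidef := hM.submatrix _

theorem block_mono {M N : Matrix (X × S) (X × S) ℂ} (h : M ≤ N) (x : X) :
    block M x ≤ block N x := by
  rw [Matrix.le_iff] at h ⊢
  exact block_posSemidef h x

theorem IsEffect.block [DecidableEq X] [DecidableEq S] {P : Matrix (X × S) (X × S) ℂ}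
    (hP : IsEffect P) (x : X) : IsEffect (QInfo.block P x) := by
  refine ⟨block_posSemidef hP.1 x, ?_⟩
  have h := block_posSemidef hP.2 x
  rw [block_sub] at h
  convert h using 2
  ext s s'
  simp [block_apply, Matrix.one_apply]

theorem trace_eq_sum_block [Fintype X] [Fintype S] (M : Matrix (X × S) (X × S) ℂ) :
    M.trace = ∑ x, (block M x).trace := by
  simp only [Matrix.trace, Matrix.diag, Fintype.sum_prod_type, block_apply]

variable [Fintype X] [DecidableEq X]

theorem ofBlocks_apply (f : X → Matrix S S ℂ) (x y : X) (s s' : S) :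
    ofBlocks f (x, s) (y, s') = if x = y then f x s s' else 0 := by
  simp only [ofBlocks, Matrix.sum_apply, Matrix.kronecker_apply, Matrix.single_apply]
  split_ifs with h
  · subst h
    rw [Finset.sum_eq_single x] <;> simp +contextual
  · refine Finset.sum_eq_zero fun z _ => ?_
    rw [if_neg, zero_mul]
    rintro ⟨rfl, rfl⟩
    exact h rfl

theorem ofBlocks_sub (f g : X → Matrix S S ℂ) :
    ofBlocks (fun x => f x - g x) = ofBlocks f - ofBlocks g := by
  ext ⟨x, s⟩ ⟨y, s'⟩
  simp only [Matrix.sub_apply, ofBlocks_apply]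
  split_ifs <;> simp

theorem ofBlocks_add (f g : X → Matrix S S ℂ) :
    ofBlocks (fun x => f x + g x) = ofBlocks f + ofBlocks g := by
  ext ⟨x, s⟩ ⟨y, s'⟩
  simp only [Matrix.add_apply, ofBlocks_apply]
  split_ifs <;> simp

theorem ofBlocks_one [DecidableEq S] :
    ofBlocks (fun _ : X => (1 : Matrix S S ℂ)) = 1 := by
  ext ⟨x, s⟩ ⟨y, s'⟩
  rw [ofBlocks_apply]
  by_cases h : x = y <;> simp [Matrix.one_apply, h]

theorem block_ofBlocks (f : X → Matrix S S ℂ) (x : X) : block (ofBlocks f) x = f x := by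
  ext s s'
  rw [block_apply, ofBlocks_apply, if_pos rfl]

variable [Fintype S]

theorem ofBlocks_posSemidef {f : X → Matrix S S ℂ} (hf : ∀ x, (f x).PosSemidef) :
    (ofBlocks f).PosSemidef := by
  classical
  refine Matrix.posSemidef_sum _ fun x _ => Matrix.PosSemidef.kronecker ?_ (hf x)
  have := Matrix.posSemidef_conjTranspose_mul_self (Matrix.single x x (1 : ℂ))
  simpa [Matrix.conjTranspose_single] using this

theorem trace_mul_ofBlocks (P : Matrix (X × S) (X × S) ℂ) (f : X → Matrix S S ℂ) :
    (P * ofBlocks f).trace = ∑ x, (block P x * f x).trace := by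
  simp only [Matrix.trace, Matrix.diag, Matrix.mul_apply, Fintype.sum_prod_type, ofBlocks_apply,
    block_apply]
  refine Finset.sum_congr rfl fun x _ => Finset.sum_congr rfl fun s _ => ?_
  rw [Finset.sum_eq_single x] <;> simp +contextual

variable [DecidableEq S]

/-- Pinching does not increase the trace norm. -/
theorem sum_traceNorm_block_le {M : Matrix (X × S) (X × S) ℂ} (hM : M.IsHermitian) :
    ∑ x, traceNorm (block M x) ≤ traceNorm M := by
  choose P _ h1 h2 h using fun x => exists_trace_mul_eq_traceNorm (hM.submatrix (Prod.mk x))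
  -- Optimal tests on the blocks assemble into an admissible test for the whole matrix.
  have hP := trace_mul_le_traceNorm hM (P := ofBlocks P)
    (by rw [← ofBlocks_one, ← ofBlocks_sub]; exact ofBlocks_posSemidef h1)
    (by rw [← ofBlocks_one, ← ofBlocks_add]; exact ofBlocks_posSemidef h2)
  rw [Matrix.trace_mul_comm, trace_mul_ofBlocks, Complex.re_sum] at hP
  refine le_trans (Finset.sum_le_sum fun x _ => ?_) hP
  rw [Matrix.trace_mul_comm]
  exact (h x).ge

theorem le_traceNorm_smul {M : Matrix S S ℂ} (hM : M.IsHermitian) {r : ℝ} (hr : 0 ≤ r) :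
    r * traceNorm M ≤ traceNorm (r • M) := by
  rcases hr.eq_or_lt with rfl | hr
  · simp [traceNorm_zero]
  · have := traceNorm_smul_le (hM.smul (IsSelfAdjoint.all r)) (inv_nonneg.2 hr.le)
    rw [smul_smul, inv_mul_cancel₀ hr.ne', one_smul] at this
    calc r * traceNorm M ≤ r * (r⁻¹ * traceNorm (r • M)) := mul_le_mul_of_nonneg_left this hr.le
      _ = traceNorm (r • M) := by rw [← mul_assoc, mul_inv_cancel₀ hr.ne', one_mul]

end Blocks

/-! ### Operator consequences of the divergences -/

section Divergence
open scoped MatrixOrder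

variable {S : Type*} [Fintype S] [DecidableEq S]

open scoped Matrix.Norms.L2Operator in
theorem le_opNorm_smul_one {N : Matrix S S ℂ} (hN : N.IsHermitian) :
    N ≤ opNorm N • (1 : Matrix S S ℂ) := by
  have h := IsSelfAdjoint.le_algebraMap_norm_self (a := N) hN
  rw [Algebra.algebraMap_eq_smul_one] at h
  exact h

theorem le_of_elog_lt {x b : ℝ} (h : elog x < b) : x ≤ 2 ^ b := by
  unfold elog at h
  split_ifs at h with hx
  · exact hx.trans (by positivity)
  · rw [EReal.coe_lt_coe_iff, Real.logb_lt_iff_lt_rpow (by norm_num) (not_le.1 hx)] at h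
    exact h.le

theorem le_of_Dinf_lt {α β : Matrix S S ℂ} (hα : α.PosSemidef) (hβ : β.PosSemidef) {b : ℝ}
    (h : Dinf α β < b) : α ≤ (2 : ℝ) ^ b • β := by
  unfold Dinf at h
  split_ifs at h with hs
  swap
  · exact absurd h not_top_lt
  have hop := le_of_elog_lt h
  have hβ' : IsSelfAdjoint β := hβ.1
  have hspec : ∀ x ∈ spectrum ℝ β, 0 ≤ x := fun x hx => spectrum_nonneg_of_nonneg hβ.nonneg hx
  set J := invSqrt β with hJ
  set H := cfc Real.sqrt β with hH
  have hJh : J.IsHermitian := cfc_predicate _ _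
  have hHh : H.IsHermitian := cfc_predicate _ _
  have hHH : H * H = β := by
    rw [hH, ← cfc_mul _ _ β (continuousOn_spectrum _ _) (continuousOn_spectrum _ _)]
    refine (cfc_congr fun x hx => ?_).trans (cfc_id' ℝ β)
    exact Real.mul_self_sqrt (hspec x hx)
  -- `H * J` is the projection onto the support of `β`, the convention `0 ^ (-1 / 2) = 0` giving
  -- zero on the kernel. By inclusion of supports it also fixes `α`, so conjugation by `H` undoes
  -- conjugation by `J`.
  have hHJβ : H * J * β = β := by
    have hJ' : J = cfc (fun x : ℝ => x ^ (-1 / 2 : ℝ)) β := rfl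
    rw [hH, hJ', ← cfc_mul _ _ β (continuousOn_spectrum _ _) (continuousOn_spectrum _ _)]
    nth_rewrite 2 [← cfc_id' ℝ β]
    rw [← cfc_mul _ _ β (continuousOn_spectrum _ _) (continuousOn_spectrum _ _)]
    refine (cfc_congr fun x hx => ?_).trans (cfc_id' ℝ β)
    rcases (hspec x hx).eq_or_lt with rfl | hx0
    · simp
    · show √x * x ^ (-1 / 2 : ℝ) * x = x
      rw [Real.sqrt_eq_rpow, ← Real.rpow_add hx0]
      norm_num
  have hHJα : H * J * α = α := by
    refine Matrix.ext_of_mulVec_single fun i => ?_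
    have : α *ᵥ Pi.single i 1 ∈ supp β := hs ⟨_, rfl⟩
    obtain ⟨w, hw⟩ := this
    simp only [Matrix.mulVecLin_apply] at hw
    rw [← Matrix.mulVec_mulVec, ← hw, Matrix.mulVec_mulVec, hHJβ]
  have hαJH : α * (J * H) = α := by
    have := congrArg Matrix.conjTranspose hHJα
    rwa [Matrix.conjTranspose_mul, Matrix.conjTranspose_mul, hα.1.eq, hJh.eq, hHh.eq] at this
  have hN : (J * α * J).IsHermitian := by
    have := Matrix.isHermitian_conjTranspose_mul_mul J hα.1
    rwa [hJh.eq] at this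
  have hle := Matrix.le_iff.1 (le_opNorm_smul_one hN)
  have h1 := hle.conjTranspose_mul_mul_same H
  have e1 : Hᴴ * (opNorm (J * α * J) • 1 - J * α * J) * H = opNorm (J * α * J) • β - α := by
    have : H * (J * α * J) * H = α := by
      calc H * (J * α * J) * H = (H * J * α) * (J * H) := by noncomm_ring
        _ = α := by rw [hHJα, hαJH]
    rw [hHh.eq, mul_sub, sub_mul, this, mul_smul_comm, mul_one, smul_mul_assoc, hHH]
  rw [e1] at h1
  have h2 := h1.add (hβ.smul (sub_nonneg.2 hop))
  rw [Matrix.le_iff]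
  convert h2 using 1
  rw [sub_smul]
  abel

theorem exists_effect_of_lt_DH {ε a : ℝ} {α β : Matrix S S ℂ} (h : (a : EReal) < DH ε α β) :
    ∃ P : Matrix S S ℂ, IsEffect P ∧ 1 - ε ≤ (P * α).trace.re ∧ (P * β).trace.re ≤ 2 ^ (-a) := by
  unfold DH at h
  simp only [lt_iSup_iff] at h
  obtain ⟨P, ⟨hP, hPα⟩, hlt⟩ := h
  refine ⟨P, hP, hPα, le_of_elog_lt ?_⟩
  rw [EReal.coe_neg]
  exact EReal.lt_neg_comm.1 hlt

theorem exists_of_DinfSmooth_lt {ε b : ℝ} {α β : Matrix S S ℂ} (hβ : β.PosSemidef)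
    (h : DinfSmooth ε α β < b) : ∃ α' : Matrix S S ℂ, IsSubState α' ∧
      traceNorm (α' - α) ≤ ε * α.trace.re ∧ α' ≤ (2 : ℝ) ^ b • β := by
  unfold DinfSmooth at h
  simp only [iInf_lt_iff] at h
  obtain ⟨α', ⟨h1, h2⟩, hlt⟩ := h
  exact ⟨α', h1, h2, le_of_Dinf_lt h1.1 hβ hlt⟩

/-- Leaves room on both sides so that the rest works with real rates, even when an information is
infinite. The case `s = ⊤` is excluded because the difference is then `⊥`. -/
theorem exists_between_of_lt_sub {x s : EReal} {R c : ℝ} (h : (R : EReal) < x - s - c) :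
    ∃ a b : ℝ, (a : EReal) < x ∧ s < b ∧ R < a - b - c := by
  induction x with
  | bot => simp at h
  | top =>
    induction s with
    | bot => exact ⟨R + c + 1, 0, EReal.coe_lt_top _, EReal.bot_lt_coe _, by linarith⟩
    | top => simp at h
    | coe s =>
      exact ⟨R + c + (s + 1) + 1, s + 1, EReal.coe_lt_top _, by
        rw [EReal.coe_lt_coe_iff]; linarith, by linarith⟩
  | coe x =>
    induction s with
    | bot =>
      exact ⟨x - 1, x - 1 - c - R - 1, by rw [EReal.coe_lt_coe_iff]; linarith,
        EReal.bot_lt_coe _, by linarith⟩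
    | top => simp at h
    | coe s =>
      rw [← EReal.coe_sub, ← EReal.coe_sub, EReal.coe_lt_coe_iff] at h
      refine ⟨x - (x - s - c - R) / 3, s + (x - s - c - R) / 3, ?_, ?_, by linarith⟩ <;>
        rw [EReal.coe_lt_coe_iff] <;> linarith

end Divergence

/-! ### Classical-quantum states, letter by letter -/

section CQ
open scoped MatrixOrder

variable {X S : Type*} [Fintype X]

theorem state_average [Fintype S] {p : X → ℝ} (hp : IsProb p) {σ : X → Matrix S S ℂ}
    (hσ : ∀ x, IsState (σ x)) : IsState (∑ x, p x • σ x) := by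
  refine ⟨Matrix.posSemidef_sum _ fun x _ => (hσ x).1.smul (hp.1 x), ?_⟩
  simp only [Matrix.trace_sum, Matrix.trace_smul, (hσ _).2, Complex.real_smul, mul_one]
  rw [← Complex.ofReal_sum, hp.2, Complex.ofReal_one]

variable [DecidableEq X]

theorem margFst_ofBlocks [Fintype S] {p : X → ℝ} {σ : X → Matrix S S ℂ} (hσ : ∀ x, (σ x).trace = 1) :
    margFst (ofBlocks fun x => p x • σ x) = Matrix.diagonal fun x => (p x : ℂ) := by
  ext x y
  simp only [margFst, reduce, Matrix.of_apply, Equiv.refl_symm, Equiv.refl_apply, ofBlocks_apply,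
    Matrix.diagonal_apply]
  split_ifs
  · have := hσ x
    rw [Matrix.trace] at this
    simp only [Matrix.smul_apply, ← Finset.smul_sum]
    simp only [Matrix.diag] at this
    rw [this, Complex.real_smul, mul_one]
  · simp

theorem margSnd_ofBlocks (f : X → Matrix S S ℂ) : margSnd (ofBlocks f) = ∑ x, f x := by
  ext s s'
  simp [margSnd, reduce, ofBlocks_apply, Matrix.sum_apply]

theorem diagonal_kronecker_eq_ofBlocks (p : X → ℝ) (τ : Matrix S S ℂ) :
    (Matrix.diagonal fun x => (p x : ℂ)) ⊗ₖ τ = ofBlocks fun x => p x • τ := by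
  ext ⟨x, s⟩ ⟨y, s'⟩
  rw [ofBlocks_apply, Matrix.kronecker_apply, Matrix.diagonal_apply]
  split_ifs <;> simp

variable [Fintype S]

theorem marg_kronecker_ofBlocks {p : X → ℝ} {σ : X → Matrix S S ℂ}
    (hσ : ∀ x, (σ x).trace = 1) :
    margFst (ofBlocks fun x => p x • σ x) ⊗ₖ margSnd (ofBlocks fun x => p x • σ x) =
      ofBlocks fun x => p x • ∑ y, p y • σ y := by
  rw [margFst_ofBlocks hσ, margSnd_ofBlocks, diagonal_kronecker_eq_ofBlocks]

variable [DecidableEq S]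

/-- The tests on the blocks extracted from a test for the mutual information of a
classical-quantum state. -/
theorem exists_effects_of_lt_IH {p : X → ℝ} {σ : X → Matrix S S ℂ}
    (hσ : ∀ x, IsState (σ x)) {ε a : ℝ}
    (h : (a : EReal) < IH ε (ofBlocks fun x => p x • σ x)) :
    ∃ Q : X → Matrix S S ℂ, (∀ x, IsEffect (Q x)) ∧
      1 - ε ≤ ∑ x, p x * (Q x * σ x).trace.re ∧
      ∑ x, ∑ y, p x * p y * (Q x * σ y).trace.re ≤ 2 ^ (-a) := by
  unfold IH at h
  rw [marg_kronecker_ofBlocks fun x => (hσ x).2] at h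
  obtain ⟨P, hP, h1, h2⟩ := exists_effect_of_lt_DH h
  refine ⟨block P, hP.block, ?_, ?_⟩
  · rw [trace_mul_ofBlocks, Complex.re_sum] at h1
    simpa [Matrix.trace_smul] using h1
  · rw [trace_mul_ofBlocks, Complex.re_sum] at h2
    refine le_trans (le_of_eq (Finset.sum_congr rfl fun x _ => ?_)) h2
    simp only [mul_smul_comm, Matrix.trace_smul, Matrix.trace_sum, Complex.smul_re,
      Complex.re_sum, smul_eq_mul, Finset.mul_sum, mul_assoc]

/-- The subnormalised operators on the blocks extracted from the smooth max mutual information of a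
classical-quantum state. -/
theorem exists_dominated_of_IinfSmooth_lt {p : X → ℝ} (hp : IsProb p) {σ : X → Matrix S S ℂ}
    (hσ : ∀ x, IsState (σ x)) {ε b : ℝ}
    (h : IinfSmooth ε (ofBlocks fun x => p x • σ x) < b) :
    ∃ α : X → Matrix S S ℂ, (∀ x, (α x).PosSemidef) ∧
      (∀ x, α x ≤ (2 : ℝ) ^ b • ∑ y, p y • σ y) ∧ ∑ x, p x * (α x).trace.re ≤ 1 ∧
      ∑ x, p x * traceNorm (α x - σ x) ≤ ε := by
  have hτ := state_average hp hσ
  unfold IinfSmooth at h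
  rw [marg_kronecker_ofBlocks fun x => (hσ x).2] at h
  obtain ⟨α', ⟨h0, h1⟩, h2, h3⟩ := exists_of_DinfSmooth_lt
    (ofBlocks_posSemidef fun x => hτ.1.smul (hp.1 x)) h
  have hb : (0 : ℝ) < 2 ^ b := by positivity
  have hblk : ∀ x, block α' x ≤ (p x * (2 : ℝ) ^ b) • ∑ y, p y • σ y := by
    intro x
    have := block_mono h3 x
    have e : block ((2 : ℝ) ^ b • ofBlocks fun x => p x • ∑ y, p y • σ y) x =
        (2 : ℝ) ^ b • block (ofBlocks fun x => p x • ∑ y, p y • σ y) x := rfl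
    rwa [e, block_ofBlocks, smul_smul, mul_comm] at this
  -- Letters of probability zero have block zero by domination, so dividing by `p x = 0` loses
  -- nothing.
  have hpα : ∀ x, p x • ((p x)⁻¹ • block α' x) = block α' x := by
    intro x
    rcases (hp.1 x).eq_or_lt with hx | hx
    · have hz : block α' x = 0 := by
        have h4 := hblk x
        rw [← hx, zero_mul, zero_smul] at h4
        exact le_antisymm h4 (block_posSemidef h0 x).nonneg
      rw [hz, smul_zero, smul_zero]
    · rw [smul_smul, mul_inv_cancel₀ hx.ne', one_smul]
  have hα0 : ∀ x, ((p x)⁻¹ • block α' x).PosSemidef := fun x =>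
    (block_posSemidef h0 x).smul (inv_nonneg.2 (hp.1 x))
  refine ⟨fun x => (p x)⁻¹ • block α' x, hα0, fun x => ?_, ?_, ?_⟩
  · change (p x)⁻¹ • block α' x ≤ _
    rcases (hp.1 x).eq_or_lt with hx | hx
    · rw [← hx, inv_zero, zero_smul]
      exact (hτ.1.smul hb.le).nonneg
    · have := (Matrix.le_iff.1 (hblk x)).smul (inv_nonneg.2 hx.le)
      rw [smul_sub, smul_smul, ← mul_assoc, inv_mul_cancel₀ hx.ne', one_mul] at this
      exact Matrix.le_iff.2 this
  · rw [trace_eq_sum_block, Complex.re_sum] at h1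
    refine le_trans (le_of_eq (Finset.sum_congr rfl fun x _ => ?_)) h1
    conv_rhs => rw [← hpα x, Matrix.trace_smul, Complex.smul_re, smul_eq_mul]
  · have htr : (ofBlocks fun x => p x • σ x).trace.re = 1 := by
      rw [trace_eq_sum_block, Complex.re_sum]
      simp only [block_ofBlocks, Matrix.trace_smul, (hσ _).2, Complex.smul_re, Complex.one_re,
        smul_eq_mul, mul_one, hp.2]
    rw [htr, mul_one] at h2
    have hherm : (α' - ofBlocks fun x => p x • σ x).IsHermitian :=
      h0.1.sub (ofBlocks_posSemidef fun x => (hσ x).1.smul (hp.1 x)).1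
    refine le_trans (Finset.sum_le_sum fun x _ => ?_) ((sum_traceNorm_block_le hherm).trans h2)
    refine (le_traceNorm_smul ((hα0 x).1.sub (hσ x).1.1) (hp.1 x)).trans (le_of_eq ?_)
    rw [smul_sub, hpα, block_sub, block_ofBlocks]

end CQ
end

/-! ### The privacy potential of one eavesdropper -/

section Privacy
open scoped MatrixOrder

variable {S X : Type*}

theorem isHermitian_sum_smul {ι : Type*} (s : Finset ι) (r : ι → ℝ) {M : ι → Matrix S S ℂ}
    (hM : ∀ i, (M i).IsHermitian) : (∑ i ∈ s, r i • M i).IsHermitian :=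
  isSelfAdjoint_sum s fun i _ => (hM i).smul (IsSelfAdjoint.all (r i))

variable [Fintype S] [DecidableEq S] [Fintype X]

theorem traceNorm_neg (M : Matrix S S ℂ) : traceNorm (-M) = traceNorm M := by
  simp [traceNorm]

theorem traceNorm_sum_smul_le {ι : Type*} (s : Finset ι) {r : ι → ℝ} (hr : ∀ i, 0 ≤ r i)
    {M : ι → Matrix S S ℂ} (hM : ∀ i, (M i).IsHermitian) :
    traceNorm (∑ i ∈ s, r i • M i) ≤ ∑ i ∈ s, r i * traceNorm (M i) :=
  (traceNorm_sum_le s fun i => (hM i).smul (IsSelfAdjoint.all (r i))).trans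
    (Finset.sum_le_sum fun i _ => traceNorm_smul_le (hM i) (hr i))

/-- Compare traces letter by letter and average. The lower bound on `l` lets additive constants be
absorbed into multiples of `l`. -/
theorem le_of_dominated {p : X → ℝ} (hp : IsProb p) {σ : X → Matrix S S ℂ}
    (hσ : ∀ x, IsState (σ x)) {α : X → Matrix S S ℂ} (hα : ∀ x, (α x).PosSemidef) {l ε : ℝ}
    (hal : ∀ x, α x ≤ l • ∑ y, p y • σ y) (hdist : ∑ x, p x * traceNorm (α x - σ x) ≤ ε) :
    1 - ε ≤ l := by
  have hτ := state_average hp hσ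
  have h1 : ∀ x, 1 - traceNorm (α x - σ x) ≤ l := fun x => by
    have h2 := trace_sub_le_traceNorm (hα x).1 (hσ x).1.1
    have h3 := trace_re_mono (hal x)
    rw [Matrix.trace_smul, hτ.2, Complex.smul_re, Complex.one_re, smul_eq_mul, mul_one] at h3
    rw [(hσ x).2, Complex.one_re] at h2
    linarith
  have h4 : ∑ x, p x * (1 - traceNorm (α x - σ x)) ≤ ∑ x, p x * l :=
    Finset.sum_le_sum fun x _ => mul_le_mul_of_nonneg_left (h1 x) (hp.1 x)
  simp only [mul_sub, mul_one, Finset.sum_sub_distrib, ← Finset.sum_mul, hp.2, one_mul] at h4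
  linarith

/-- A nonnegative function of the codewords of a message, small on average, controlling the distance
between the state of an eavesdropper and its average. -/
theorem exists_privacy_potential {p : X → ℝ} (hp : IsProb p) {σ : X → Matrix S S ℂ}
    (hσ : ∀ x, IsState (σ x)) {α : X → Matrix S S ℂ} (hα : ∀ x, (α x).PosSemidef) {l ε : ℝ}
    (hl : 0 < l) (hε : 0 < ε) (hal : ∀ x, α x ≤ l • ∑ y, p y • σ y)
    (htr : ∑ x, p x * (α x).trace.re ≤ 1) (hdist : ∑ x, p x * traceNorm (α x - σ x) ≤ ε)
    {K : ℕ} (hK : 0 < K) :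
    ∃ V : (Fin K → X) → ℝ, (∀ x, 0 ≤ V x) ∧
      expect p V ≤ ((l + 1) * ε + 2 * l) / (K * ε ^ 2) ∧
      ∀ x, V x < 1 →
        traceNorm ((K : ℝ)⁻¹ • ∑ k, σ (x k) - ∑ y, p y • σ y) < 4 * ε := by
  have hK' : (0 : ℝ) < K := by exact_mod_cast hK
  have hτ := state_average hp hσ
  have hher : ∀ x, (α x - σ x).IsHermitian := fun x => (hα x).1.sub (hσ x).1.1
  let g : X → ℝ := fun x => traceNorm (α x - σ x)
  have hg0 : ∀ x, 0 ≤ g x := fun x => traceNorm_nonneg (hher x)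
  have hg1 : ∀ x, g x ≤ l + 1 := fun x => by
    have h2 := traceNorm_sub_le_trace_add (hα x) (hσ x).1
    have h3 := trace_re_mono (hal x)
    rw [Matrix.trace_smul, hτ.2, Complex.smul_re, Complex.one_re, smul_eq_mul, mul_one] at h3
    rw [(hσ x).2, Complex.one_re] at h2
    exact h2.trans (by linarith)
  -- Two fluctuations are controlled: the smoothing distance averaged over the chosen letters, and
  -- the covering error of the smoothed operators.
  let dev : (Fin K → X) → ℝ := fun x => (K : ℝ)⁻¹ • ∑ k, g (x k) - ∑ y, p y • g y
  let h : (Fin K → X) → ℝ := fun x =>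
    traceNorm ((K : ℝ)⁻¹ • ∑ k, α (x k) - ∑ y, p y • α y)
  refine ⟨fun x => (ε ^ 2)⁻¹ * (dev x ^ 2 + h x ^ 2), fun x => by positivity, ?_, fun x hx => ?_⟩
  · rw [expect_mul_left, expect_add]
    have h1 : expect p (fun x => dev x ^ 2) ≤ (K : ℝ)⁻¹ * ((l + 1) * ε) := by
      have hv := expect_empirical_variance_le hp (LinearMap.mul ℝ ℝ)
        (fun v => mul_self_nonneg v) g hK
      simp only [LinearMap.mul_apply', ← pow_two] at hv
      refine hv.trans (mul_le_mul_of_nonneg_left ?_ (by positivity))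
      calc ∑ y, p y * g y ^ 2 ≤ ∑ y, (l + 1) * (p y * g y) := by
            refine Finset.sum_le_sum fun y _ => ?_
            have := mul_le_mul_of_nonneg_left
              (mul_le_mul_of_nonneg_right (hg1 y) (hg0 y)) (hp.1 y)
            nlinarith
        _ ≤ (l + 1) * ε := by
            rw [← Finset.mul_sum]
            exact mul_le_mul_of_nonneg_left hdist (by linarith)
    have h2 : expect p (fun x => h x ^ 2) ≤ 2 * l / K :=
      expect_traceNorm_sq_le hp hτ hα hl hal htr hK
    calc (ε ^ 2)⁻¹ * (expect p (fun x => dev x ^ 2) + expect p fun x => h x ^ 2)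
        ≤ (ε ^ 2)⁻¹ * ((K : ℝ)⁻¹ * ((l + 1) * ε) + 2 * l / K) :=
          mul_le_mul_of_nonneg_left (add_le_add h1 h2) (by positivity)
      _ = _ := by field_simp
  · rw [inv_mul_lt_iff₀ (by positivity), mul_one] at hx
    have hd : dev x < ε := lt_of_pow_lt_pow_left₀ 2 hε.le (by nlinarith [sq_nonneg (h x)])
    have hh : h x < ε := lt_of_pow_lt_pow_left₀ 2 hε.le (by nlinarith [sq_nonneg (dev x)])
    have hq : ∑ y, p y * g y ≤ ε := hdist
    have hKs : ∀ f : X → Matrix S S ℂ, (K : ℝ)⁻¹ • ∑ k, f (x k) = ∑ k, (K : ℝ)⁻¹ • f (x k) :=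
      fun f => Finset.smul_sum
    -- Four contributions of `ε`: mean and fluctuation of the smoothing distance in the first term,
    -- covering in the second, the mean smoothing distance again in the third.
    have hdec : (K : ℝ)⁻¹ • ∑ k, σ (x k) - ∑ y, p y • σ y =
        -∑ k, (K : ℝ)⁻¹ • (α (x k) - σ (x k)) +
          ((K : ℝ)⁻¹ • ∑ k, α (x k) - ∑ y, p y • α y) + ∑ y, p y • (α y - σ y) := by
      simp only [smul_sub, Finset.sum_sub_distrib, hKs]
      abel
    have i1 : (∑ k, (K : ℝ)⁻¹ • (α (x k) - σ (x k))).IsHermitian :=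
      isHermitian_sum_smul _ _ fun k => hher (x k)
    have i2 : ((K : ℝ)⁻¹ • ∑ k, α (x k) - ∑ y, p y • α y).IsHermitian := by
      rw [hKs]
      exact (isHermitian_sum_smul _ _ fun k => (hα (x k)).1).sub
        (isHermitian_sum_smul _ _ fun y => (hα y).1)
    have i3 : (∑ y, p y • (α y - σ y)).IsHermitian := isHermitian_sum_smul _ _ hher
    have j1 : traceNorm (∑ k, (K : ℝ)⁻¹ • (α (x k) - σ (x k))) ≤ ∑ k, (K : ℝ)⁻¹ * g (x k) :=
      traceNorm_sum_smul_le _ (fun _ => by positivity) fun k => hher (x k)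
    have j3 : traceNorm (∑ y, p y • (α y - σ y)) ≤ ∑ y, p y * g y :=
      traceNorm_sum_smul_le _ hp.1 hher
    have hd' : ∑ k, (K : ℝ)⁻¹ * g (x k) - ∑ y, p y * g y < ε := by
      simpa only [dev, smul_eq_mul, Finset.mul_sum] using hd
    rw [hdec]
    have k1 := traceNorm_add_le (i1.neg.add i2) i3
    have k2 := traceNorm_add_le i1.neg i2
    rw [traceNorm_neg] at k2
    have hh' : traceNorm ((K : ℝ)⁻¹ • ∑ k, α (x k) - ∑ y, p y • α y) < ε := hh
    linarith

end Privacy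

/-! ### Numerical estimates -/

section Numerics

/-- The rate penalty pays for the collision term when `ε < 2 / 5`: one factor `t` and a power of
`ε⁻¹` come from the size of `K`. -/
theorem rpow_neg_mul_le {t ε : ℝ} (ht : 2 ≤ t) (hε : 0 < ε) (hε1 : ε < 2 / 5) :
    t ^ (-(4 / ε ^ 2)) * (45600 * t) ≤ ε ^ 3 := by
  set u := 1 / ε ^ 2 with hu
  have hu6 : 6 ≤ u := by
    rw [hu, le_div_iff₀ (by positivity)]
    nlinarith
  have ht0 : 0 < t := by linarith
  have h4u : 4 / ε ^ 2 = 4 * u := by rw [hu]; ring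
  have hB : 302 * u ≤ (4 : ℝ) ^ u := by
    -- Bernoulli's inequality with `4096 = 4 ^ 6`; it needs exponent `u / 6 ≥ 1`.
    have h1 := one_add_mul_self_le_rpow_one_add (s := 4095) (p := u / 6) (by norm_num)
      (by linarith)
    have h2 : (1 + 4095 : ℝ) ^ (u / 6) = (4 : ℝ) ^ u := by
      rw [show (1 + 4095 : ℝ) = (4 : ℝ) ^ (6 : ℝ) by norm_num, ← Real.rpow_mul (by norm_num)]
      congr 1
      ring
    rw [h2] at h1
    linarith
  have h16 : 91200 * u ^ 2 ≤ (2 : ℝ) ^ (4 * u) := by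
    have h1 : (2 : ℝ) ^ (4 * u) = ((4 : ℝ) ^ u) ^ 2 := by
      rw [← Real.rpow_natCast, ← Real.rpow_mul (by norm_num),
        show (4 : ℝ) = (2 : ℝ) ^ (2 : ℝ) by norm_num, ← Real.rpow_mul (by norm_num)]
      congr 1
      push_cast
      norm_num
      ring
    rw [h1]
    have h2 : (302 * u) ^ 2 ≤ ((4 : ℝ) ^ u) ^ 2 := pow_le_pow_left₀ (by linarith) hB 2
    nlinarith [sq_nonneg u]
  have hsplit : t ^ (4 * u) = t ^ (4 * u - 1) * t := by
    rw [Real.rpow_sub_one ht0.ne']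
    field_simp
  have hge : (2 : ℝ) ^ (4 * u - 1) ≤ t ^ (4 * u - 1) :=
    Real.rpow_le_rpow (by norm_num) ht (by linarith)
  have h2s : (2 : ℝ) ^ (4 * u - 1) = (2 : ℝ) ^ (4 * u) / 2 := Real.rpow_sub_one (by norm_num) _
  have hmain : 45600 * u ^ 2 * t ≤ t ^ (4 * u) := by
    rw [hsplit]
    refine mul_le_mul_of_nonneg_right ?_ ht0.le
    linarith
  have hpos : 0 < t ^ (4 * u) := by positivity
  have hε4 : u ^ 2 * ε ^ 3 * ε = 1 := by rw [hu]; field_simp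
  have hε3 : 1 ≤ u ^ 2 * ε ^ 3 := by
    have : 0 < u ^ 2 * ε ^ 3 := by positivity
    nlinarith
  rw [h4u, Real.rpow_neg ht0.le, inv_mul_le_iff₀ hpos]
  calc 45600 * t ≤ 45600 * t * (u ^ 2 * ε ^ 3) := le_mul_of_one_le_right (by positivity) hε3
    _ = 45600 * u ^ 2 * t * ε ^ 3 := by ring
    _ ≤ t ^ (4 * u) * ε ^ 3 := mul_le_mul_of_nonneg_right hmain (by positivity)

theorem rpow_neg_le {t ε : ℝ} (ht : 2 ≤ t) (hε : 0 < ε) (hε1 : ε < 1 / 2) :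
    t ^ (-(4 / ε ^ 2)) ≤ 1 / 65536 := by
  have h16 : 16 ≤ 4 / ε ^ 2 := by
    rw [le_div_iff₀ (by positivity)]
    nlinarith
  have ht0 : 0 < t := by linarith
  have h : (65536 : ℝ) ≤ t ^ (4 / ε ^ 2) :=
    calc (65536 : ℝ) = (2 : ℝ) ^ (16 : ℝ) := by norm_num
      _ ≤ t ^ (16 : ℝ) := Real.rpow_le_rpow (by norm_num) ht (by norm_num)
      _ ≤ t ^ (4 / ε ^ 2) := Real.rpow_le_rpow_of_exponent_le (by linarith) h16
  rw [Real.rpow_neg ht0.le, one_div]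
  exact inv_anti₀ (by norm_num) h

theorem rpow_mul_rpow_mul_rpow_le {t : ℕ} (ht : 2 ≤ t) {ε a b R : ℝ}
    (h : R < a - b - 4 * Real.logb 2 t / ε ^ 2) :
    (2 : ℝ) ^ R * 2 ^ b * 2 ^ (-a) ≤ (t : ℝ) ^ (-(4 / ε ^ 2)) := by
  have ht0 : (0 : ℝ) < t := by exact_mod_cast (by lia : 0 < t)
  have e : (t : ℝ) ^ (-(4 / ε ^ 2)) = (2 : ℝ) ^ (-(4 * Real.logb 2 t / ε ^ 2)) := by
    nth_rewrite 1 [← Real.rpow_logb (b := 2) (x := (t : ℝ)) (by norm_num) (by norm_num) ht0]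
    rw [← Real.rpow_mul (by norm_num)]
    congr 1
    ring
  rw [e, ← Real.rpow_add (by norm_num), ← Real.rpow_add (by norm_num)]
  exact Real.rpow_le_rpow_of_exponent_le (by norm_num) (by linarith)

end Numerics

/-! ### Marginals of channel outputs and of the control state -/

section Marginals

variable {S K D : Type*} [Fintype D]

theorem reduce_eq_sum (e : S ≃ K × D) (σ : Matrix S S ℂ) :
    reduce e σ = ∑ d, σ.submatrix (fun k => e.symm (k, d)) fun k => e.symm (k, d) := by
  ext k k'
  simp [reduce, Matrix.sum_apply]

theorem reduce_smul (e : S ≃ K × D) (r : ℝ) (σ : Matrix S S ℂ) :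
    reduce e (r • σ) = r • reduce e σ := by
  ext k k'
  simp only [reduce, Matrix.of_apply, Matrix.smul_apply, Finset.smul_sum]

theorem reduce_add (e : S ≃ K × D) (σ τ : Matrix S S ℂ) :
    reduce e (σ + τ) = reduce e σ + reduce e τ := by
  ext k k'
  simp only [reduce, Matrix.of_apply, Matrix.add_apply, Finset.sum_add_distrib]

theorem IsState.reduce [Fintype S] [Fintype K] (e : S ≃ K × D) {σ : Matrix S S ℂ}
    (hσ : IsState σ) : IsState (QInfo.reduce e σ) := by
  refine ⟨?_, ?_⟩
  · rw [reduce_eq_sum]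
    exact Matrix.posSemidef_sum _ fun d _ => hσ.1.submatrix _
  · rw [← hσ.2]
    simp only [Matrix.trace, Matrix.diag, QInfo.reduce, Matrix.of_apply]
    rw [← Fintype.sum_prod_type' (fun k d => σ (e.symm (k, d)) (e.symm (k, d)))]
    exact e.symm.sum_comp fun s => σ s s

/-- The partial trace after a linear map, as a real linear map. -/
noncomputable def reduceMap {A : Type*} (T : Matrix A A ℂ →ₗ[ℂ] Matrix S S ℂ) (e : S ≃ K × D) :
    Matrix A A ℂ →ₗ[ℝ] Matrix K K ℂ where
  toFun ω := reduce e (T ω)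
  map_add' ω ω' := by rw [map_add, reduce_add]
  map_smul' r ω := by rw [LinearMap.map_smul_of_tower, reduce_smul, RingHom.id_apply]

theorem IsCPTP.isState {A : Type*} [Fintype A] [Fintype S]
    {T : Matrix A A ℂ →ₗ[ℂ] Matrix S S ℂ} (hT : IsCPTP T) {ρ : Matrix A A ℂ} (hρ : IsState ρ) :
    IsState (T ρ) := by
  refine ⟨?_, (hT.2 ρ).trans hρ.2⟩
  -- A one-dimensional ancilla turns complete positivity into positivity.
  have h := hT.1 1 (ρ.submatrix Prod.fst Prod.fst) (hρ.1.submatrix _)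
  exact h.submatrix fun s => (s, 0)

variable {X A : Type*} [Fintype X] [DecidableEq X]

theorem controlState_eq_ofBlocks (T : Matrix A A ℂ →ₗ[ℂ] Matrix S S ℂ) (p : X → ℝ)
    (ρ : X → Matrix A A ℂ) :
    controlState T p ρ = ofBlocks fun x => p x • T (ρ x) := by
  refine Finset.sum_congr rfl fun x _ => ?_
  rw [← Matrix.kronecker_smul]
  rfl

theorem margXB_controlState {t : ℕ} {B : Type*} {E : Fin t → Type*} [∀ i, Fintype (E i)]
    (T : Matrix A A ℂ →ₗ[ℂ] Matrix (B × ∀ i, E i) (B × ∀ i, E i) ℂ) (p : X → ℝ)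
    (ρ : X → Matrix A A ℂ) :
    margXB (controlState T p ρ) = ofBlocks fun x => p x • margFst (T (ρ x)) := by
  rw [controlState_eq_ofBlocks]
  ext ⟨x, b⟩ ⟨y, b'⟩
  simp only [margXB, margFst, reduce, Matrix.of_apply, Equiv.symm_symm, Equiv.prodAssoc_apply,
    ofBlocks_apply, Matrix.smul_apply, Equiv.refl_symm, Equiv.refl_apply]
  split_ifs
  · rw [Finset.smul_sum]
  · simp

theorem margXE_controlState {t : ℕ} {B : Type*} {E : Fin t → Type*} [Fintype B]
    [∀ i, Fintype (E i)] (T : Matrix A A ℂ →ₗ[ℂ] Matrix (B × ∀ i, E i) (B × ∀ i, E i) ℂ)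
    (p : X → ℝ) (ρ : X → Matrix A A ℂ) (i : Fin t) :
    margXE i (controlState T p ρ) = ofBlocks fun x => p x • margE i (T (ρ x)) := by
  rw [controlState_eq_ofBlocks]
  ext ⟨x, b⟩ ⟨y, b'⟩
  simp only [margXE, margE, reduce, Matrix.of_apply, Equiv.symm_trans_apply, Equiv.symm_symm,
    Equiv.prodAssoc_apply, Equiv.prodCongr_symm, Equiv.prodCongr_apply, Prod.map,
    ofBlocks_apply, Matrix.smul_apply, Equiv.refl_symm, Equiv.refl_apply]
  split_ifs
  · rw [Finset.smul_sum]
  · simp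

end Marginals

/-! ### Assembling the private code -/

section Codes

variable {A B : Type*} [Fintype A] [Fintype B] [DecidableEq B]

theorem IsState.mix {ω ω' : Matrix A A ℂ} (h : IsState ω) (h' : IsState ω') {r s : ℝ}
    (hr : 0 ≤ r) (hs : 0 ≤ s) (hrs : r + s = 1) : IsState (r • ω + s • ω') := by
  refine ⟨(h.1.smul hr).add (h'.1.smul hs), ?_⟩
  rw [Matrix.trace_add, Matrix.trace_smul, Matrix.trace_smul, h.2, h'.2, ← add_smul, hrs, one_smul]

theorem IsState.empirical {K : ℕ} (hK : 0 < K) {ω : Fin K → Matrix A A ℂ}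
    (h : ∀ k, IsState (ω k)) : IsState ((K : ℝ)⁻¹ • ∑ k, ω k) := by
  have hK' : (K : ℂ) ≠ 0 := by exact_mod_cast hK.ne'
  refine ⟨(Matrix.posSemidef_sum _ fun k _ => (h k).1).smul (by positivity), ?_⟩
  rw [Matrix.trace_smul, Matrix.trace_sum]
  simp [(h _).2, hK']

/-- The constant code, whose decoder always announces the first message. -/
theorem exists_constant_code {ω : Matrix A A ℂ} (hω : IsState ω) {M : ℕ} (hM : 0 < M) {ε : ℝ}
    (hε : 0 < ε) (h : M ≤ 1 ∨ 1 / 2 ≤ ε) (𝓑 : Matrix A A ℂ → Matrix B B ℂ)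
    (h𝓑 : IsState (𝓑 ω)) : ∃ C : PrivateCode A B M,
      (∀ m, C.enc m = ω) ∧ ∀ m, 1 - (C.dec m * 𝓑 (C.enc m)).trace.re ≤ 2 * ε := by
  obtain ⟨D, hD0, hD1, -⟩ := exists_povm_ge (B := B) hM (fun _ => 0)
    (fun _ => Matrix.PosSemidef.zero) (by simpa using Matrix.PosSemidef.one)
  refine ⟨⟨fun _ => ω, fun _ => hω, D, hD0, hD1⟩, fun _ => rfl, fun m => ?_⟩
  change 1 - (D m * 𝓑 ω).trace.re ≤ 2 * ε
  rcases h with h | h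
  · have : M = 1 := le_antisymm h hM
    subst this
    rw [Fin.sum_univ_one, ← Subsingleton.elim m 0] at hD1
    rw [hD1, one_mul, h𝓑.2, Complex.one_re]
    linarith
  · linarith [trace_mul_re_nonneg (hD0 m) h𝓑.1]

variable {X : Type*} [Fintype X] [DecidableEq X] {t : ℕ} {E : Fin t → Type*} [∀ i, Fintype (E i)]
  [∀ i, DecidableEq (E i)]

/-- One-shot private coding from tests on the receiver's side and dominated approximations on the
eavesdroppers' side. -/
theorem exists_private_code (ht : 2 ≤ t) {p : X → ℝ} (hp : IsProb p)
    {ρ : X → Matrix A A ℂ} (hρ : ∀ x, IsState (ρ x))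
    (𝓑 : Matrix A A ℂ →ₗ[ℝ] Matrix B B ℂ) (h𝓑 : ∀ ω, IsState ω → IsState (𝓑 ω))
    (𝓔 : ∀ i, Matrix A A ℂ →ₗ[ℝ] Matrix (E i) (E i) ℂ) (h𝓔 : ∀ i ω, IsState ω → IsState (𝓔 i ω))
    {ε a b R : ℝ} (hε0 : 0 < ε)
    (ha : (a : EReal) < IH ε (ofBlocks fun x => p x • 𝓑 (ρ x)))
    (hb : ∀ i, IinfSmooth ε (ofBlocks fun x => p x • 𝓔 i (ρ x)) < b)
    (hR : R < a - b - 4 * Real.logb 2 t / ε ^ 2) :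
    ∃ C : PrivateCode A B ⌈(2 : ℝ) ^ R⌉₊,
      (∀ m, 1 - (C.dec m * 𝓑 (C.enc m)).trace.re ≤ 2 * ε) ∧
      ∀ i m, traceNorm (𝓔 i (C.enc m) - ∑ x, p x • 𝓔 i (ρ x)) < 4 * ε := by
  set ω₀ := ∑ x, p x • ρ x with hω₀
  have hω₀s : IsState ω₀ := state_average hp hρ
  have h𝓔₀ : ∀ i, 𝓔 i ω₀ = ∑ x, p x • 𝓔 i (ρ x) := fun i => by
    rw [hω₀, map_sum]; simp only [map_smul]
  simp only [← h𝓔₀]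
  have hR0 : (0 : ℝ) < 2 ^ R := by positivity
  set M := ⌈(2 : ℝ) ^ R⌉₊ with hM
  have hM0 : 0 < M := Nat.ceil_pos.2 hR0
  -- Sending the average input leaks nothing; it decodes perfectly if there is one message, and an
  -- error of `2 * ε ≥ 1` is no constraint.
  by_cases htriv : M ≤ 1 ∨ 1 / 2 ≤ ε
  · obtain ⟨C, hC, hC'⟩ := exists_constant_code hω₀s hM0 hε0 htriv 𝓑 (h𝓑 _ hω₀s)
    refine ⟨C, hC', fun i m => ?_⟩
    rw [hC, sub_self, traceNorm_zero]
    linarith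
  push Not at htriv
  obtain ⟨hM1, hε2⟩ := htriv
  -- Two or more messages force `2 ^ R > 1`, so rounding up at most doubles.
  have hMle : (M : ℝ) ≤ 2 * 2 ^ R := by
    have h1 : (1 : ℝ) < 2 ^ R := by
      have := Nat.lt_ceil.1 hM1
      exact_mod_cast this
    have := Nat.ceil_lt_add_one hR0.le
    rw [← hM] at this
    linarith
  obtain ⟨Q, hQ, hQε, hQq⟩ := exists_effects_of_lt_IH (fun x => h𝓑 _ (hρ x)) ha
  choose α hα0 hαl hαtr hαd using fun i =>
    exists_dominated_of_IinfSmooth_lt hp (fun x => h𝓔 i _ (hρ x)) (hb i)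
  set l : ℝ := 2 ^ b with hl
  set q : ℝ := 2 ^ (-a) with hq
  have hq0 : 0 < q := by positivity
  have hl1 : 1 - ε ≤ l :=
    le_of_dominated hp (fun x => h𝓔 ⟨0, by lia⟩ _ (hρ x)) (hα0 _) (hαl _) (hαd _)
  have hl0 : 0 < l := by linarith
  have hx : (2 : ℝ) ^ R * l * q ≤ (t : ℝ) ^ (-(4 / ε ^ 2)) := rpow_mul_rpow_mul_rpow_le ht hR
  have ht2 : (2 : ℝ) ≤ t := by exact_mod_cast ht
  have hMq : ∀ c : ℝ, 0 ≤ c → (M : ℝ) * (l * c) * q ≤ 2 * c * (t : ℝ) ^ (-(4 / ε ^ 2)) := by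
    intro c hc
    calc (M : ℝ) * (l * c) * q ≤ 2 * 2 ^ R * (l * c) * q := by gcongr
      _ = 2 * c * (2 ^ R * l * q) := by ring
      _ ≤ _ := mul_le_mul_of_nonneg_left hx (by positivity)
  rcases lt_or_ge ε (2 / 5) with hε5 | hε5
  · have hz := rpow_neg_mul_le ht2 hε0 hε5
    set z := (t : ℝ) ^ (-(4 / ε ^ 2)) with hzdef
    -- The constant `56` brings the summed potentials to `2 / 35 ≤ 1 / 16`; rounding up to `K` costs
    -- at most `57` in its place.
    set L : ℝ := l * (56 * t / ε ^ 2) with hL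
    have hL0 : 0 < L := by positivity
    set K := ⌈L⌉₊ with hK
    have hK0 : 0 < K := Nat.ceil_pos.2 hL0
    have hK' : (0 : ℝ) < K := by exact_mod_cast hK0
    have hLK : L ≤ K := Nat.le_ceil L
    have hKL : (K : ℝ) ≤ l * (57 * t / ε ^ 2) := by
      have h1 := Nat.ceil_lt_add_one hL0.le
      rw [← hK] at h1
      have h2 : 2 ≤ t / ε ^ 2 := by
        rw [le_div_iff₀ (by positivity)]
        nlinarith
      have h3 : l * (57 * t / ε ^ 2) = L + l * (t / ε ^ 2) := by rw [hL]; ring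
      rw [h3]
      nlinarith
    choose V hV0 hVe hV using fun i => exists_privacy_potential hp (fun x => h𝓔 i _ (hρ x))
      (hα0 i) hl0 hε0 (hαl i) (hαtr i) (hαd i) hK0
    have hVsum : expect p (fun x => ∑ i, V i x) ≤ 1 / 16 := by
      rw [expect_sum]
      calc ∑ i, expect p (V i) ≤ ∑ _i : Fin t, ((l + 1) * ε + 2 * l) / (K * ε ^ 2) :=
            Finset.sum_le_sum fun i _ => hVe i
        _ = t * (((l + 1) * ε + 2 * l) / (K * ε ^ 2)) := by simp
        _ ≤ t * ((16 / 5 * l) / (L * ε ^ 2)) := by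
            gcongr
            nlinarith
        _ = 16 / 5 / 56 := by rw [hL]; field_simp
        _ ≤ 1 / 16 := by norm_num
    have hMK : (4 : ℕ) * (M : ℝ) * K * q ≤ ε / 100 := by
      calc (4 : ℕ) * (M : ℝ) * K * q ≤ 4 * ((M : ℝ) * (l * (57 * t / ε ^ 2)) * q) := by
            push_cast
            have : (M : ℝ) * K * q ≤ (M : ℝ) * (l * (57 * t / ε ^ 2)) * q := by gcongr
            linarith
        _ ≤ 4 * (2 * (57 * t / ε ^ 2) * z) :=
            mul_le_mul_of_nonneg_left (hMq _ (by positivity)) (by norm_num)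
        _ = (z * (45600 * t)) / (100 * ε ^ 2) := by
          field_simp
          norm_num
          ring
        _ ≤ ε ^ 3 / (100 * ε ^ 2) := by gcongr
        _ = ε / 100 := by field_simp
    -- The budget is exact: error `11 / 16` plus leakage `1 / 16` equals `1 - 1 / 4`, so `N = 4`.
    obtain ⟨x, D, hD0, hD1, hxD⟩ := exists_code hp (fun x => h𝓑 _ (hρ x)) hQ hQε hQq
      (δ := ε / 100) (e := 2 * ε) (v := 1 / 16) (by positivity) (by positivity) hK0 hM0
      (N := 4) (by norm_num) (fun x => ∑ i, V i x)
      (fun x => Finset.sum_nonneg fun i _ => hV0 i x) hVsum (by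
        have : (5 / 4 * ε + 25 / 4 * ((4 : ℕ) * (M : ℝ) * K * q + ε / 100)) / (2 * ε) ≤
            11 / 16 := by
          rw [div_le_iff₀ (by positivity)]
          linarith
        push_cast at this ⊢
        linarith)
    refine ⟨⟨fun m => (K : ℝ)⁻¹ • ∑ k, ρ (x m k), fun m => IsState.empirical hK0 fun k => hρ _,
      D, hD0, hD1⟩, fun m => ?_, fun i m => ?_⟩
    · have := (hxD m).1
      simpa only [map_smul, map_sum] using this
    · have h1 : V i (x m) < 1 :=
        (Finset.single_le_sum (fun j _ => hV0 j (x m)) (Finset.mem_univ i)).trans_lt (hxD m).2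
      have := hV i (x m) h1
      rw [h𝓔₀]
      simpa only [map_smul, map_sum] using this
  · have hz := rpow_neg_le ht2 hε0 hε2
    set z := (t : ℝ) ^ (-(4 / ε ^ 2)) with hzdef
    have hMK : (16 : ℕ) * (M : ℝ) * (1 : ℕ) * q ≤ 1 / 1024 := by
      have h1 := hMq 2 (by norm_num)
      have h2 : (M : ℝ) * q ≤ (M : ℝ) * (l * 2) * q := by
        have : (1 : ℝ) ≤ l * 2 := by linarith
        have h3 : 0 ≤ (M : ℝ) * q := by positivity
        nlinarith
      push_cast
      linarith
    -- No covering here: one letter per message and error `7 / 10`. Mixing in the average input with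
    -- weight `1 / 4` raises the error to at most `31 / 40 < 4 / 5 ≤ 2 * ε` and leaves a distance of
    -- at most `3 / 4 * 2 < 8 / 5 ≤ 4 * ε`.
    obtain ⟨x, D, hD0, hD1, hxD⟩ := exists_code hp (fun x => h𝓑 _ (hρ x)) hQ hQε hQq
      (δ := 1 / 1024) (e := 7 / 10) (v := 0) (by norm_num) (by norm_num) (K := 1) one_pos hM0
      (N := 16) (by norm_num) (fun _ => 0) (fun _ => le_rfl) (expect_const hp 0).le (by
        rw [add_zero, div_le_iff₀ (by norm_num)]
        push_cast at hMK ⊢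
        linarith)
    have hst : ∀ m, IsState ((1 / 4 : ℝ) • ω₀ + (3 / 4 : ℝ) • ρ (x m 0)) := fun m =>
      hω₀s.mix (hρ _) (by norm_num) (by norm_num) (by norm_num)
    refine ⟨⟨fun m => (1 / 4 : ℝ) • ω₀ + (3 / 4 : ℝ) • ρ (x m 0), hst, D, hD0, hD1⟩,
      fun m => ?_, fun i m => ?_⟩
    · have h1 := (hxD m).1
      simp only [Nat.cast_one, inv_one, one_smul, Fin.sum_univ_one] at h1
      have h2 := trace_mul_re_nonneg (hD0 m) (h𝓑 _ hω₀s).1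
      change 1 - (D m * 𝓑 ((1 / 4 : ℝ) • ω₀ + (3 / 4 : ℝ) • ρ (x m 0))).trace.re ≤ 2 * ε
      rw [map_add, map_smul, map_smul, mul_add, mul_smul_comm, mul_smul_comm, Matrix.trace_add,
        Matrix.trace_smul, Matrix.trace_smul, Complex.add_re, Complex.smul_re, Complex.smul_re,
        smul_eq_mul, smul_eq_mul]
      linarith
    · change traceNorm (𝓔 i ((1 / 4 : ℝ) • ω₀ + (3 / 4 : ℝ) • ρ (x m 0)) - 𝓔 i ω₀) < 4 * ε
      have hs1 := h𝓔 i _ (hρ (x m 0))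
      have hs2 := h𝓔 i _ hω₀s
      have e1 : 𝓔 i ((1 / 4 : ℝ) • ω₀ + (3 / 4 : ℝ) • ρ (x m 0)) - 𝓔 i ω₀ =
          (3 / 4 : ℝ) • (𝓔 i (ρ (x m 0)) - 𝓔 i ω₀) := by
        rw [map_add, map_smul, map_smul]
        module
      have h1 := traceNorm_smul_le (hs1.1.1.sub hs2.1.1) (r := 3 / 4) (by norm_num)
      have h2 := traceNorm_sub_le_trace_add hs1.1 hs2.1
      rw [hs1.2, hs2.2, Complex.one_re] at h2
      rw [e1]
      linarith

end Codes

end QInfo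

/-! ### The wiretap theorem -/

open QInfo
theorem theorem3 {t : ℕ} (ht : 2 ≤ t) {A B X : Type*} {E : Fin t → Type*}
    [Fintype A] [Fintype B] [DecidableEq B] [Fintype X] [DecidableEq X]
    [∀ i, Fintype (E i)] [∀ i, DecidableEq (E i)]
    (T : Matrix A A ℂ →ₗ[ℂ] Matrix (B × ∀ i, E i) (B × ∀ i, E i) ℂ) (hT : IsCPTP T)
    (p : X → ℝ) (hp : IsProb p) (ρ : X → Matrix A A ℂ) (hρ : ∀ x, IsState (ρ x))
    (ε : ℝ) (hε0 : 0 < ε) (hε1 : ε < 1) (R : ℝ)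
    (hR : (R : EReal) < IH ε (margXB (controlState T p ρ)) -
      (⨆ i, IinfSmooth ε (margXE i (controlState T p ρ))) -
      ((4 * Real.logb 2 t / ε ^ 2 : ℝ) : EReal)) :
    ∃ C : PrivateCode A B ⌈(2 : ℝ) ^ R⌉₊,
      (∀ m, C.errorProb T m ≤ 2 * ε) ∧
      ∀ i m, traceNorm (C.eveState T i m - margSnd (margXE i (controlState T p ρ))) < 4 * ε := by
  obtain ⟨a, b, ha, hb, hab⟩ := exists_between_of_lt_sub hR
  simp only [margXB_controlState, margXE_controlState, margSnd_ofBlocks] at *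
  exact exists_private_code ht hp hρ (reduceMap T (Equiv.refl _))
    (fun ω hω => (hT.isState hω).reduce _) (fun i => reduceMap T (splitEve B E i))
    (fun i ω hω => (hT.isState hω).reduce _) hε0 ha
    (fun i => (le_iSup _ i).trans_lt hb) hab
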